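/- Let $k\ge 1$ and let $\Lambda$ be a finite, strongly connected $k$-graph with at least one vertex: a small category with a degree functor $d:\Lambda\to\mathbb N^k$ that has the factorization property, with finitely many morphisms of each degree, and with $a\Lambda b\neq\emptyset$ for all vertices $a,b$. Let $A_i(a,b)=\#(a\Lambda^{e_i}b)$ $(1\le i\le k)$ be its adjacency matrices, $\rho_i$ the spectral radius of $A_i$, and $x^\Lambda\in(0,\infty)^{\Lambda^0}$ the unique positive vector with $\sum_v x^\Lambda_v=1$ and $A_ix^\Lambda=\rho_ix^\Lambda$ for all $i$. Let $\mathcal B_\Lambda$ be the stationary $k$-Bratteli diagram of $(A_1,\dots,A_k)$: every level $\mathcal V_n$ $(n\in\mathbb N)$ is a copy of $\Lambda^0$, and for $n\ge1$ there are $A_i(p,q)$ edges with source $q\in\mathcal V_n$ and range $p\in\mathcal V_{n-1}$, where $i\equiv n \pmod k$. Let $F\mathcal B_\Lambda$ be the set of finite paths with range in $\mathcal V_0$ (vertices of $\mathcal V_0$ being the paths of length $0$), let $F_\gamma\mathcal B_\Lambda$ be the set of those that extend $\gamma$ (including $\gamma$), and let $X=X_{\mathcal B_\Lambda}$ be the space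 of infinite paths, with the topology generated by the cylinder sets $[\gamma]$ (the set of infinite paths that begin with $\gamma$), $\gamma\in F\mathcal B_\Lambda$. Fix $\delta\in(0,1)$. For $\eta\in F\mathcal B_\Lambda$ of length $qk+t$, $0\le t<k$, put $$w_\delta(\eta)=\bigl(\rho_1^{q+1}\cdots\rho_t^{q+1}\rho_{t+1}^q\cdots\rho_k^q\bigr)^{-1/\delta}\,x^\Lambda_{s(\eta)}.$$ Let $d_\delta(x,y)$ be $0$ if $x=y$, $1$ if $x,y$ have different ranges, and $w_\delta(x\wedge y)$ otherwise, where $x\wedge y$ is the longest common initial path. Assume that $w_\delta(\gamma)=\operatorname{diam}[\gamma]:=\sup\{d_\delta(x,y):x,y\in[\gamma]\}$ for all $\gamma\in F\mathcal B_\Lambda$. On $\ell^2(F\mathcal B_\Lambda)\otimes\mathbb C^2$ let $D=\bigoplus_{\gamma}\frac1{\operatorname{diam}[\gamma]}\begin{pmatrix}0&1\\1&0\end{pmatrix}$ and put $\zeta_\delta(s)=\frac12\operatorname{Tr}(|D|^{-s})\in[0,\infty]$ for $s\in\mathbb R$ (under the assumption above, $\zeta_\delta(s)=\sum_{\lambda\in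 F\mathcal B_\Lambda}w_\delta(\lambda)^s$). For a choice function $\tau=(\tau_+,\tau_-)$, that is, $\tau_\pm(\gamma)\in[\gamma]$ with $d_\delta(\tau_+(\gamma),\tau_-(\gamma))=\operatorname{diam}[\gamma]$ for all $\gamma$, let $\pi_\tau(f)=\bigoplus_\gamma\begin{pmatrix}f(\tau_+(\gamma))&0\\0&f(\tau_-(\gamma))\end{pmatrix}$. Then $\zeta_\delta(s)<\infty$ if and only if $s>\delta$; and there is a unique finite Borel measure $\mu_\delta$ on $X$ such that $$\mu_\delta([\gamma])=\lim_{s\searrow\delta}\frac{\sum_{\lambda\in F_\gamma\mathcal B_\Lambda}w_\delta(\lambda)^s}{\zeta_\delta(s)}\qquad\text{for all }\gamma\in F\mathcal B_\Lambda;$$ in particular all these limits exist and are finite. Moreover the spectral triple is $\zeta$-regular and its Dixmier trace is integration against $\mu_\delta$: for every choice function $\tau$ and every function $f:X\to\mathbb C$ that is Lipschitz for $d_\delta$, $f$ is $\mu_\delta$-integrable, the operators $|D|^{-s}$ and $|D|^{-s}\pi_\tau(f)$ are trace class for all $s>\delta$, and $$\lim_{s\searrow\delta}\frac{\operatorname{Tr}(|D|^{-s}\pi_\tau(f))}{\operatorname{Tr}(|D|^{-s})}=\int_X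 f\,d\mu_\delta .$$ -/

import Mathlib

open CategoryTheory MeasureTheory Filter Topology
open scoped ENNReal

universe u v

/-! ### Bratteli diagrams, finite and infinite paths -/

/-- A Bratteli diagram.  `E n p q` is the set of edges of `𝓔_{n+1}` with range `p ∈ 𝓥_n` and
source `q ∈ 𝓥_{n+1}`. -/
structure BratteliDiagram where
  V : ℕ → Type u
  E : (n : ℕ) → V n → V (n + 1) → Type v
  finite_V : ∀ n, Finite (V n)
  finite_E : ∀ n p q, Finite (E n p q)

namespace BratteliDiagram

/-- `B.PathTo n q` is the set of paths of length `n` with range in `𝓥_0` and source `q ∈ 𝓥_n`.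
The paths of length `0` are the vertices in `𝓥_0`. -/
inductive PathTo (B : BratteliDiagram.{u, v}) : (n : ℕ) → B.V n → Type (max u v)
  | vertex (p : B.V 0) : PathTo B 0 p
  | snoc {n : ℕ} {p : B.V n} {q : B.V (n + 1)} (η : PathTo B n p) (e : B.E n p q) :
      PathTo B (n + 1) q

/-- The set `F𝓑` of all finite paths with range in `𝓥_0`: triples (length, source, path). -/
abbrev FinitePath (B : BratteliDiagram.{u, v}) : Type (max u v) :=
  Σ (n : ℕ) (q : B.V n), B.PathTo n q

/-- `B.IsSubPath η μ`: the finite path `η` is a sub-path of `μ`, i.e. `μ` is obtained from `η` by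
appending finitely many (possibly zero) edges. -/
inductive IsSubPath (B : BratteliDiagram.{u, v}) (η : B.FinitePath) : B.FinitePath → Prop
  | refl : IsSubPath B η η
  | snoc {n : ℕ} {p : B.V n} {q : B.V (n + 1)} {μ : B.PathTo n p} (e : B.E n p q)
      (h : IsSubPath B η ⟨n, p, μ⟩) : IsSubPath B η ⟨n + 1, q, μ.snoc e⟩

/-- The infinite path space `X_𝓑`. -/
structure InfinitePath (B : BratteliDiagram.{u, v}) where
  vertex : (n : ℕ) → B.V n
  edge : (n : ℕ) → B.E n (vertex n) (vertex (n + 1))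

namespace InfinitePath

variable {B : BratteliDiagram.{u, v}}

/-- The first `n` edges of an infinite path. -/
def takeTo (x : B.InfinitePath) : (n : ℕ) → B.PathTo n (x.vertex n)
  | 0 => PathTo.vertex (x.vertex 0)
  | n + 1 => (takeTo x n).snoc (x.edge n)

/-- The sub-path of length `n` of an infinite path. -/
def take (x : B.InfinitePath) (n : ℕ) : B.FinitePath := ⟨n, x.vertex n, x.takeTo n⟩

/-- The longest common sub-path `x ∧ y` of two distinct infinite paths with the same range. -/
noncomputable def meet (x y : B.InfinitePath) : B.FinitePath :=
  x.take (sSup {n | x.take n = y.take n})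

end InfinitePath

/-- The cylinder set `[γ]`. -/
def cylinder (B : BratteliDiagram.{u, v}) (γ : B.FinitePath) : Set B.InfinitePath :=
  {x | x.take γ.1 = γ}

/-- The topology of `X_𝓑` generated by the cylinder sets. -/
instance (B : BratteliDiagram.{u, v}) : TopologicalSpace B.InfinitePath :=
  TopologicalSpace.generateFrom (Set.range B.cylinder)

instance (B : BratteliDiagram.{u, v}) : MeasurableSpace B.InfinitePath := borel _

instance (B : BratteliDiagram.{u, v}) : BorelSpace B.InfinitePath := ⟨rfl⟩

/-! ### The ultrametric of a weight and the associated spectral triple -/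

open Classical in
/-- The function `d_w` on `X_𝓑 × X_𝓑`. -/
noncomputable def pathDist (B : BratteliDiagram.{u, v}) (w : B.FinitePath → ℝ)
    (x y : B.InfinitePath) : ℝ :=
  if x = y then 0 else if x.vertex 0 ≠ y.vertex 0 then 1 else w (x.meet y)

/-- The diameter of the cylinder set `[γ]` with respect to `d_w`. -/
noncomputable def diam (B : BratteliDiagram.{u, v}) (w : B.FinitePath → ℝ)
    (γ : B.FinitePath) : ℝ :=
  sSup {r | ∃ x ∈ B.cylinder γ, ∃ y ∈ B.cylinder γ, r = B.pathDist w x y}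

/-- A choice function `τ = (τ₊, τ₋)`. -/
structure ChoiceFunction (B : BratteliDiagram.{u, v}) (w : B.FinitePath → ℝ) where
  pos : B.FinitePath → B.InfinitePath
  neg : B.FinitePath → B.InfinitePath
  pos_mem : ∀ γ, pos γ ∈ B.cylinder γ
  neg_mem : ∀ γ, neg γ ∈ B.cylinder γ
  dist_eq : ∀ γ, B.pathDist w (pos γ) (neg γ) = B.diam w γ

/-- `f ∈ C_Lip(X_𝓑)`: Lipschitz continuity with respect to `d_w`. -/
def IsLipschitz (B : BratteliDiagram.{u, v}) (w : B.FinitePath → ℝ)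
    (f : B.InfinitePath → ℂ) : Prop :=
  ∃ C : ℝ, ∀ x y, ‖f x - f y‖ ≤ C * B.pathDist w x y

/-- Block diagonal operators on `ℓ²(F𝓑) ⊗ ℂ² = ⨁_{γ ∈ F𝓑} ℂ²`, given by their `2 × 2` blocks. -/
abbrev BlockOperator (B : BratteliDiagram.{u, v}) : Type (max u v) :=
  B.FinitePath → Matrix (Fin 2) (Fin 2) ℂ

/-- The Dirac operator `D = ⨁_γ (1 / diam [γ]) (0 1; 1 0)`. -/
noncomputable def dirac (B : BratteliDiagram.{u, v}) (w : B.FinitePath → ℝ) : B.BlockOperator :=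
  fun γ => ((1 / B.diam w γ : ℝ) : ℂ) • !![0, 1; 1, 0]

/-- The operator `|D|^{-s}`, by the functional calculus in each block. -/
noncomputable def absDiracPow (B : BratteliDiagram.{u, v}) (w : B.FinitePath → ℝ) (s : ℝ) :
    B.BlockOperator :=
  fun γ => cfc (fun t : ℝ => |t| ^ (-s)) (B.dirac w γ)

/-- The operator `π_τ(f) = ⨁_γ (f(τ₊(γ)) 0; 0 f(τ₋(γ)))`. -/
def rep (B : BratteliDiagram.{u, v}) {w : B.FinitePath → ℝ} (τ : B.ChoiceFunction w)
    (f : B.InfinitePath → ℂ) : B.BlockOperator :=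
  fun γ => !![f (τ.pos γ), 0; 0, f (τ.neg γ)]

/-- A block diagonal operator is trace class in the sense used here if the series of the traces of
its blocks converges absolutely; `blockTrace` is then its trace. -/
def TraceSummable (B : BratteliDiagram.{u, v}) (T : B.BlockOperator) : Prop :=
  Summable fun γ => (T γ).trace

/-- The trace of a block diagonal operator. -/
noncomputable def blockTrace (B : BratteliDiagram.{u, v}) (T : B.BlockOperator) : ℂ :=
  ∑' γ, (T γ).trace

/-- The trace, with values in `[0, ∞]`, of a positive block diagonal operator. -/
noncomputable def positiveTrace (B : BratteliDiagram.{u, v}) (T : B.BlockOperator) : ℝ≥0∞ :=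
  ∑' γ, ENNReal.ofReal (T γ).trace.re

/-- The zeta function `ζ_w(s) = (1/2) Tr (|D|^{-s}) ∈ [0, ∞]` for real `s`. -/
noncomputable def zeta (B : BratteliDiagram.{u, v}) (w : B.FinitePath → ℝ) (s : ℝ) : ℝ≥0∞ :=
  2⁻¹ * B.positiveTrace (B.absDiracPow w s)

/-- The sum `∑ w(μ)^s ∈ [0, ∞]` over all finite paths `μ` that extend `γ`. -/
noncomputable def extensionSum (B : BratteliDiagram.{u, v}) (w : B.FinitePath → ℝ)
    (γ : B.FinitePath) (s : ℝ) : ℝ≥0∞ :=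
  ∑' μ : {μ : B.FinitePath // B.IsSubPath γ μ}, ENNReal.ofReal (w μ.1 ^ s)

/-- The Dixmier trace of `f`, taken at `s₀`, exists and equals `c`. -/
def HasDixmierTrace (B : BratteliDiagram.{u, v}) {w : B.FinitePath → ℝ} (τ : B.ChoiceFunction w)
    (s₀ : ℝ) (f : B.InfinitePath → ℂ) (c : ℂ) : Prop :=
  (∀ s, s₀ < s → B.TraceSummable (B.absDiracPow w s) ∧
      B.TraceSummable (B.absDiracPow w s * B.rep τ f)) ∧
    Tendsto (fun s : ℝ => B.blockTrace (B.absDiracPow w s * B.rep τ f) /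
      B.blockTrace (B.absDiracPow w s)) (𝓝[>] s₀) (𝓝 c)

/-! ### Stationary `k`-Bratteli diagrams -/

/-- The stationary `k`-Bratteli diagram of `A 0, …, A (k - 1)`; the edges from level `n + 1` to
level `n` are given by the matrix `A (n mod k)`. -/
abbrev stationary {k : ℕ} [NeZero k] {ι : Type u} [Finite ι] (A : Fin k → Matrix ι ι ℕ) :
    BratteliDiagram.{u, 0} where
  V _ := ι
  E n p q := Fin (A (Fin.ofNat k n) p q)
  finite_V _ := inferInstance
  finite_E _ _ _ := inferInstance

end BratteliDiagram

/-! ### Perron-Frobenius data and the weights `w_δ` -/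

section PerronFrobenius

variable {k : ℕ} {ι : Type u} [Fintype ι] [DecidableEq ι]

/-- The spectral radius of a matrix with entries in `ℕ`. -/
noncomputable def natSpectralRadius (M : Matrix ι ι ℕ) : ℝ :=
  (spectralRadius ℂ (M.map (Nat.cast : ℕ → ℂ))).toReal

/-- `x` is a positive vector of `ℓ¹`-norm one with `A_i x = ρ(A_i) x` for all `i`. -/
def IsPerronFrobenius (A : Fin k → Matrix ι ι ℕ) (x : ι → ℝ) : Prop :=
  (∀ a, 0 < x a) ∧ ∑ a, x a = 1 ∧
    ∀ i, ((A i).map (Nat.cast : ℕ → ℝ)).mulVec x = natSpectralRadius (A i) • x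

open Classical in
/-- The Perron-Frobenius eigenvector of a family of matrices (zero if there is none). -/
noncomputable def perronFrobenius (A : Fin k → Matrix ι ι ℕ) : ι → ℝ :=
  if h : ∃ x, IsPerronFrobenius A x then h.choose else 0

/-- The function `w_δ`.  For a path of length `n = q k + t` with `0 ≤ t < k` and with source `b`,
its value is `(ρ₁^{q+1} ⋯ ρ_t^{q+1} ρ_{t+1}^q ⋯ ρ_k^q)^{-1/δ} x_b`. -/
noncomputable def deltaWeight [NeZero k] (A : Fin k → Matrix ι ι ℕ) (δ : ℝ)
    (η : (BratteliDiagram.stationary A).FinitePath) : ℝ :=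
  (∏ i : Fin k, natSpectralRadius (A i) ^ (if i.val < η.1 % k then η.1 / k + 1 else η.1 / k)) ^
    (-(1 / δ)) * perronFrobenius A η.2.1

end PerronFrobenius

/-! ### Higher-rank graphs -/

/-- A `k`-graph structure on a category `Λ`.  A morphism `f : a ⟶ b` has source `a` and range `b`,
so the product `μν` of composable morphisms is `ν ≫ μ`. -/
structure KGraph (k : ℕ) (Λ : Type u) [Category.{v} Λ] where
  countable : Countable (Σ (a : Λ) (b : Λ), (a ⟶ b))
  d : {a b : Λ} → (a ⟶ b) → (Fin k → ℕ)
  d_id : ∀ a : Λ, d (𝟙 a) = 0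
  d_comp : ∀ {a b c : Λ} (f : a ⟶ b) (g : b ⟶ c), d (f ≫ g) = d f + d g
  factorization : ∀ {a b : Λ} (f : a ⟶ b) (m n : Fin k → ℕ), d f = m + n →
    ∃! p : Σ c : Λ, (c ⟶ b) × (a ⟶ c), d p.2.1 = m ∧ d p.2.2 = n ∧ p.2.2 ≫ p.2.1 = f

namespace KGraph

variable {k : ℕ} {Λ : Type u} [Category.{v} Λ]

/-- `Λ` is finite: there are finitely many morphisms of each degree. -/
def IsFinite (G : KGraph k Λ) : Prop :=
  ∀ n : Fin k → ℕ, Finite {f : Σ (a : Λ) (b : Λ), (a ⟶ b) // G.d f.2.2 = n}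

/-- `Λ` is strongly connected: `aΛb` is non-empty for all vertices `a`, `b`. -/
def IsStronglyConnected (_G : KGraph k Λ) : Prop :=
  ∀ a b : Λ, Nonempty (b ⟶ a)

/-- The adjacency matrices `A_i(a, b) = #(a Λ^{e_i} b)`. -/
noncomputable def adjacency (G : KGraph k Λ) (i : Fin k) : Matrix Λ Λ ℕ :=
  fun a b => Nat.card {f : b ⟶ a // G.d f = Pi.single i 1}

/-- The stationary `k`-Bratteli diagram `𝓑_Λ`. -/
noncomputable abbrev bratteli [NeZero k] [Finite Λ] (G : KGraph k Λ) : BratteliDiagram.{u, 0} :=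
  BratteliDiagram.stationary G.adjacency

/-- The function `w_δ` on `F𝓑_Λ`. -/
noncomputable def weight [NeZero k] [Fintype Λ] [DecidableEq Λ] (G : KGraph k Λ) (δ : ℝ) :
    G.bratteli.FinitePath → ℝ :=
  deltaWeight G.adjacency δ

end KGraph

/-! Let `L_n` be the product of spectral radii attached to length `n`. It factors as `κ ^ n` times a
`k`-periodic factor, with `κ` the geometric mean of the `ρ_i`. Writing `L_n ^ (-s/δ) = L_n⁻¹ * L_n ^
(1 - s/δ)`, the factor `L_n⁻¹` normalizes the path counts. Hence the sum of `w ^ s` over the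
extensions of a path is, up to explicit factors, an Abel sum `∑ r ^ j T ^ j y_s` with `r = κ ^ (1 -
s/δ)`. Here `T` is a positive operator on functions on `Fin k × Λ⁰` that fixes the Perron-Frobenius
vector (`extensionSum_sourceWeight`).

The positive fixed vector makes `T` power bounded, so `(1 - r) ∑ r ^ j T ^ j y` converges as `r ↗ 1`
to a positive vector (`exists_tendsto_abel_of_tendsto`). The powers `T ^ j` themselves may
oscillate. Quotients of such sums therefore converge. The abscissa is exactly `δ` once `κ > 1`, and
this comes from the diameter hypothesis: every cylinder has two points, so paths keep branching,
which is impossible if the normalized masses do not decay (`one_lt_growthRate`).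

The measure is a weak limit. For any `z γ ∈ [γ]`, normalize the point masses `w(γ) ^ s` at `z γ`.
The path space is compact, cylinders are clopen, and the mass of `[η]` differs from the required
quotient only by the finitely many paths shorter than `η`, which are negligible. So all cluster
points have the same cylinder masses and coincide (`exists_tendsto_pointMeasure`). Taking `z = τ₊`
and `z = τ₋`, the quotient of traces is the mean of two such integrals, which gives the Dixmier
trace. -/

namespace BratteliDiagram

/-! ### Finite paths and the extension order. -/

variable {B : BratteliDiagram.{u, v}}

/-- The paths of length `n`. -/
abbrev Level (B : BratteliDiagram.{u, v}) (n : ℕ) : Type (max u v) := Σ q : B.V n, B.PathTo n q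

namespace PathTo

/-- A path of length `n + 1` is a path of length `n` followed by an edge. -/
def succEquiv (B : BratteliDiagram.{u, v}) (n : ℕ) (q : B.V (n + 1)) :
    B.PathTo (n + 1) q ≃ Σ p : B.V n, B.PathTo n p × B.E n p q where
  toFun | .snoc (p := p) η e => ⟨p, η, e⟩
  invFun x := .snoc x.2.1 x.2.2
  left_inv | .snoc _ _ => rfl
  right_inv _ := rfl

theorem finite (n : ℕ) (q : B.V n) : Finite (B.PathTo n q) := by
  induction n with
  | zero =>
    have : Subsingleton (B.PathTo 0 q) := ⟨by rintro ⟨⟩ ⟨⟩; rfl⟩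
    infer_instance
  | succ n ih =>
    have := B.finite_V n
    have := fun p => B.finite_E n p q
    exact Finite.of_equiv _ (succEquiv B n q).symm

end PathTo

instance (n : ℕ) : Finite (B.Level n) := by
  have := B.finite_V n
  have := fun q => PathTo.finite (B := B) n q
  infer_instance

instance : Countable B.FinitePath :=
  inferInstanceAs (Countable (Σ n, B.Level n))

/-- Removing the last edge of a path. -/
def parent : B.FinitePath → B.FinitePath
  | ⟨0, p, η⟩ => ⟨0, p, η⟩
  | ⟨_ + 1, _, .snoc (p := p) η _⟩ => ⟨_, p, η⟩

namespace IsSubPath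

theorem length_le {η μ : B.FinitePath} (h : B.IsSubPath η μ) : η.1 ≤ μ.1 := by
  induction h with
  | refl => exact le_rfl
  | snoc e h ih => exact ih.trans (Nat.le_succ _)

theorem eq_of_length_le {η μ : B.FinitePath} (h : B.IsSubPath η μ) (hl : μ.1 ≤ η.1) : η = μ := by
  cases h with
  | refl => rfl
  | snoc e h => exact absurd h.length_le (by simpa using hl)

/-- From the length of `η` on, the last edge is irrelevant to whether a path extends `η`. This is
the invariance under which sums over levels can be reduced edge by edge. -/
theorem snoc_iff {η : B.FinitePath} {n : ℕ} (hn : η.1 ≤ n) {p : B.V n} {q : B.V (n + 1)}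
    {μ : B.PathTo n p} {e : B.E n p q} :
    B.IsSubPath η ⟨n + 1, q, μ.snoc e⟩ ↔ B.IsSubPath η ⟨n, p, μ⟩ := by
  refine ⟨fun h => ?_, fun h => .snoc e h⟩
  cases h with
  | refl => exact absurd hn (by simp)
  | snoc e h => exact h

end IsSubPath

/-! ### Topology and Borel structure of the path space. -/

namespace InfinitePath

/-- The first `n` edges of an infinite path, as a member of `Level n`. -/
def level (x : B.InfinitePath) (n : ℕ) : B.Level n := ⟨x.vertex n, x.takeTo n⟩

theorem take_eq_mk_iff {x : B.InfinitePath} {n : ℕ} {η : B.Level n} :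
    x.take n = ⟨n, η⟩ ↔ x.level n = η := by
  constructor
  · intro h; exact eq_of_heq (Sigma.mk.inj h).2
  · rintro rfl; rfl

theorem take_eq_take_iff {x y : B.InfinitePath} {n : ℕ} :
    x.take n = y.take n ↔ x.level n = y.level n := take_eq_mk_iff (η := y.level n)

theorem take_eq_of_isSubPath {x : B.InfinitePath} {η μ : B.FinitePath} (h : B.IsSubPath η μ)
    (hx : x.take μ.1 = μ) : x.take η.1 = η := by
  induction h with
  | refl => exact hx
  | snoc e h ih => exact ih (congrArg parent hx)

theorem isSubPath_take (x : B.InfinitePath) {m n : ℕ} (h : m ≤ n) :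
    B.IsSubPath (x.take m) (x.take n) := by
  induction n, h using Nat.le_induction with
  | base => exact .refl
  | succ n _ ih => exact .snoc _ ih

theorem take_eq_take_of_le {x y : B.InfinitePath} {m n : ℕ} (hmn : m ≤ n)
    (h : x.take n = y.take n) : x.take m = y.take m :=
  take_eq_of_isSubPath (y.isSubPath_take hmn) h

/-- All points of `[μ]` share their initial segments up to the length of `μ`, so membership in a
cylinder of a shorter path is decided by `μ` alone. The length bound is essential: `[μ]` may be
split by longer paths. -/
theorem mem_cylinder_iff_isSubPath {x : B.InfinitePath} {η μ : B.FinitePath}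
    (hx : x ∈ B.cylinder μ) (hl : η.1 ≤ μ.1) : x ∈ B.cylinder η ↔ B.IsSubPath η μ := by
  refine ⟨fun h => ?_, fun h => take_eq_of_isSubPath h hx⟩
  have := x.isSubPath_take hl
  rwa [show x.take η.1 = η from h, show x.take μ.1 = μ from hx] at this

theorem ext_take {x y : B.InfinitePath} (h : ∀ n, x.take n = y.take n) : x = y := by
  have h' : ∀ n, x.level n = y.level n := fun n => take_eq_take_iff.1 (h n)
  obtain ⟨v, e⟩ := x
  obtain ⟨v', e'⟩ := y
  obtain rfl : v = v' := funext fun n => congrArg Sigma.fst (h' n)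
  congr 1
  funext n
  have h1 := eq_of_heq (Sigma.mk.inj (h' (n + 1))).2
  simp only [takeTo] at h1
  injection h1

/-- A sequence of finite paths, each extending the previous one by an edge, defines an infinite
path. -/
theorem exists_level_eq (η : (n : ℕ) → B.Level n)
    (h : ∀ n, ∃ x : B.InfinitePath, x.level n = η n ∧ x.level (n + 1) = η (n + 1)) :
    ∃ y : B.InfinitePath, ∀ n, y.level n = η n := by
  have h1 : ∀ n, ∃ e : B.E n (η n).1 (η (n + 1)).1, η (n + 1) = ⟨_, (η n).2.snoc e⟩ := by
    intro n
    obtain ⟨x, h1, h2⟩ := h n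
    rw [← h1, ← h2]
    exact ⟨x.edge n, rfl⟩
  choose e he using h1
  refine ⟨⟨fun n => (η n).1, e⟩, fun n => ?_⟩
  have : takeTo ⟨fun n => (η n).1, e⟩ n = (η n).2 := by
    induction n with
    | zero =>
      simp only [takeTo]
      generalize η 0 = a
      obtain ⟨p, b⟩ := a
      cases b; rfl
    | succ n ih =>
      rw [takeTo, ih]
      have := he n
      exact eq_of_heq (Sigma.mk.inj (Sigma.eta _ ▸ this)).2.symm
  exact Sigma.ext rfl (heq_of_eq this)

theorem isOpen_cylinder (γ : B.FinitePath) : IsOpen (B.cylinder γ) :=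
  TopologicalSpace.isOpen_generateFrom_of_mem ⟨γ, rfl⟩

theorem compl_cylinder (γ : B.FinitePath) :
    (B.cylinder γ)ᶜ = ⋃ η ∈ {η : B.FinitePath | η.1 = γ.1 ∧ η ≠ γ}, B.cylinder η := by
  ext x
  simp only [Set.mem_compl_iff, Set.mem_iUnion, Set.mem_ofPred_eq, exists_prop]
  constructor
  · intro h
    exact ⟨x.take γ.1, ⟨rfl, h⟩, rfl⟩
  · rintro ⟨η, ⟨h1, h2⟩, h3⟩ h4
    apply h2
    rw [← show x.take η.1 = η from h3, ← show x.take γ.1 = γ from h4, h1]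

/-- Clopen sets have empty frontier, so weak convergence of measures implies convergence on
cylinders. -/
theorem isClopen_cylinder (γ : B.FinitePath) : IsClopen (B.cylinder γ) := by
  refine ⟨⟨?_⟩, isOpen_cylinder γ⟩
  rw [compl_cylinder]
  exact isOpen_biUnion fun η _ => isOpen_cylinder η

instance : T2Space B.InfinitePath := by
  refine ⟨fun x y hxy => ?_⟩
  obtain ⟨n, hn⟩ : ∃ n, x.take n ≠ y.take n := by
    by_contra! h
    exact hxy (ext_take h)
  refine ⟨B.cylinder (x.take n), B.cylinder (y.take n), isOpen_cylinder _, isOpen_cylinder _,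
    rfl, rfl, Set.disjoint_left.2 fun z h1 h2 => hn ?_⟩
  rw [← show z.take n = x.take n from h1, ← show z.take n = y.take n from h2]

instance : SecondCountableTopology B.InfinitePath :=
  ⟨⟨Set.range B.cylinder, Set.countable_range _, rfl⟩⟩

/-- A form of König's lemma: levels are finite, so an ultrafilter is eventually constant on each of
them, and the constants assemble to its limit. -/
instance : CompactSpace B.InfinitePath := by
  refine ⟨isCompact_iff_ultrafilter_le_nhds.2 fun F _ => ?_⟩
  have h1 : ∀ n, ∃ η : B.Level n, ∀ᶠ x in (F : Filter B.InfinitePath), x.level n = η := by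
    intro n
    obtain ⟨η, hη⟩ := Ultrafilter.eq_pure_of_finite (F.map fun x => x.level n)
    refine ⟨η, ?_⟩
    have : ({η} : Set (B.Level n)) ∈ F.map fun x => x.level n := by
      rw [hη]; exact Set.mem_singleton η
    exact this
  choose η hη using h1
  -- Two eventual conditions hold at a common point, which makes consecutive levels compatible.
  obtain ⟨y, hy⟩ := exists_level_eq η fun n => ((hη n).and (hη (n + 1))).exists
  refine ⟨y, Set.mem_univ _, ?_⟩
  rw [TopologicalSpace.nhds_generateFrom]
  refine le_iInf₂ fun s hs => ?_
  obtain ⟨h1, γ, rfl⟩ := hs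
  rw [le_principal_iff]
  filter_upwards [hη γ.1] with x hx
  change x.take γ.1 = γ
  exact (take_eq_take_iff.2 (hx.trans (hy _).symm)).trans h1

/-- Two cylinders that meet are nested. -/
theorem isPiSystem_cylinder : IsPiSystem (Set.range B.cylinder) := by
  rintro _ ⟨γ, rfl⟩ _ ⟨η, rfl⟩ ⟨x, hx, hy⟩
  rcases le_total γ.1 η.1 with h | h
  · refine ⟨η, (Set.inter_eq_self_of_subset_right fun z hz => ?_).symm⟩
    exact (mem_cylinder_iff_isSubPath hz h).2 ((mem_cylinder_iff_isSubPath hy h).1 hx)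
  · refine ⟨γ, (Set.inter_eq_self_of_subset_left fun z hz => ?_).symm⟩
    exact (mem_cylinder_iff_isSubPath hz h).2 ((mem_cylinder_iff_isSubPath hx h).1 hy)

/-- A finite measure on the infinite path space is determined by its values on cylinder sets. -/
theorem measure_ext {μ ν : Measure B.InfinitePath} [IsFiniteMeasure μ]
    (h : ∀ γ, μ (B.cylinder γ) = ν (B.cylinder γ)) : μ = ν := by
  refine Measure.ext_of_generateFrom_of_cover_subset (S := Set.range B.cylinder)
    (T := Set.range B.cylinder) ?_ isPiSystem_cylinder subset_rfl (Set.countable_range _) ?_ ?_ ?_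
  · exact borel_eq_generateFrom_of_subbasis rfl
  · rw [Set.sUnion_range]
    exact Set.eq_univ_of_forall fun x => Set.mem_iUnion.2 ⟨x.take 0, rfl⟩
  · rintro _ ⟨γ, rfl⟩; exact measure_ne_top μ _
  · rintro _ ⟨γ, rfl⟩; exact h γ

end InfinitePath

end BratteliDiagram

/-! ### Normalized point masses and their weak limits. -/

namespace BratteliDiagram

variable {B : BratteliDiagram.{u, v}}

/-- The series `∑ w(γ)^s` over all finite paths. -/
noncomputable def pathSum (B : BratteliDiagram.{u, v}) (w : B.FinitePath → ℝ) (s : ℝ) : ℝ≥0∞ :=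
  ∑' γ, ENNReal.ofReal (w γ ^ s)

/-- The normalized sum of the point masses at `z γ` with weights `w(γ)^s`. -/
noncomputable def pointMeasure (w : B.FinitePath → ℝ) (z : B.FinitePath → B.InfinitePath)
    (s : ℝ) : Measure B.InfinitePath :=
  (B.pathSum w s)⁻¹ • Measure.sum fun γ => ENNReal.ofReal (w γ ^ s) • Measure.dirac (z γ)

theorem measurableSet_cylinder (γ : B.FinitePath) : MeasurableSet (B.cylinder γ) :=
  (InfinitePath.isOpen_cylinder γ).measurableSet

theorem finite_setOf_length_lt (n : ℕ) : {γ : B.FinitePath | γ.1 < n}.Finite := by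
  have : {γ : B.FinitePath | γ.1 < n} ⊆
      ⋃ m ∈ Finset.range n, Set.range (fun η : B.Level m => (⟨m, η⟩ : B.FinitePath)) := by
    rintro ⟨m, η⟩ h
    simp only [Set.mem_iUnion]
    exact ⟨m, Finset.mem_range.2 h, η, rfl⟩
  exact ((Finset.range n).finite_toSet.biUnion fun m _ => Set.finite_range _).subset this

section

variable {w : B.FinitePath → ℝ} {z : B.FinitePath → B.InfinitePath} {l : Filter ℝ}
  {c : B.FinitePath → ℝ≥0∞}

theorem isProbabilityMeasure_pointMeasure {s : ℝ} (h0 : B.pathSum w s ≠ 0)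
    (h1 : B.pathSum w s ≠ ∞) : IsProbabilityMeasure (pointMeasure w z s) := by
  refine ⟨?_⟩
  simp only [pointMeasure, Measure.smul_apply, Measure.sum_apply _ MeasurableSet.univ,
    measure_univ, smul_eq_mul, mul_one]
  exact ENNReal.inv_mul_cancel h0 h1

/-- For `γ` at least as long as `η`, `z γ ∈ [η]` exactly when `γ` extends `η`. Only the finitely
many shorter paths can contribute differently, and each has vanishing normalized weight. -/
theorem tendsto_pointMeasure_cylinder (hz : ∀ γ, z γ ∈ B.cylinder γ)
    (h0 : ∀ γ, Tendsto (fun s : ℝ => ENNReal.ofReal (w γ ^ s) / B.pathSum w s) l (𝓝 0))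
    (hc : ∀ γ, Tendsto (fun s => B.extensionSum w γ s / B.pathSum w s) l (𝓝 (c γ)))
    (η : B.FinitePath) :
    Tendsto (fun s => pointMeasure w z s (B.cylinder η)) l (𝓝 (c η)) := by
  classical
  have hS := finite_setOf_length_lt (B := B) η.1
  have hle : ∀ s, B.extensionSum w η s / B.pathSum w s ≤ pointMeasure w z s (B.cylinder η) ∧
      pointMeasure w z s (B.cylinder η) ≤ B.extensionSum w η s / B.pathSum w s +
        ∑ γ ∈ hS.toFinset, ENNReal.ofReal (w γ ^ s) / B.pathSum w s := by
    intro s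
    have h1 : pointMeasure w z s (B.cylinder η) =
        (∑' γ, ENNReal.ofReal (w γ ^ s) * (B.cylinder η).indicator 1 (z γ)) / B.pathSum w s := by
      simp only [pointMeasure, Measure.smul_apply, Measure.sum_apply _ (measurableSet_cylinder η),
        Measure.dirac_apply' _ (measurableSet_cylinder η), smul_eq_mul]
      rw [mul_comm, div_eq_mul_inv]
    have h2 : B.extensionSum w η s =
        ∑' γ, {γ | B.IsSubPath η γ}.indicator (fun γ => ENNReal.ofReal (w γ ^ s)) γ :=
      tsum_subtype {γ | B.IsSubPath η γ} fun γ => ENNReal.ofReal (w γ ^ s)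
    have h3 : ∑ γ ∈ hS.toFinset, ENNReal.ofReal (w γ ^ s) / B.pathSum w s =
        (∑' γ, {γ : B.FinitePath | γ.1 < η.1}.indicator
          (fun γ => ENNReal.ofReal (w γ ^ s)) γ) / B.pathSum w s := by
      rw [tsum_eq_sum (s := hS.toFinset), ENNReal.div_eq_inv_mul, Finset.mul_sum]
      · refine Finset.sum_congr rfl fun γ hγ => ?_
        rw [Set.indicator_of_mem (by simpa using hγ), ENNReal.div_eq_inv_mul]
      · intro γ hγ
        exact Set.indicator_of_notMem (by simpa using hγ) _
    rw [h1, h2, h3, ← ENNReal.add_div, ← ENNReal.tsum_add]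
    refine ⟨ENNReal.div_le_div_right (ENNReal.tsum_le_tsum fun γ => ?_) _,
      ENNReal.div_le_div_right (ENNReal.tsum_le_tsum fun γ => ?_) _⟩
    · by_cases h : B.IsSubPath η γ
      · have : z γ ∈ B.cylinder η :=
          (InfinitePath.mem_cylinder_iff_isSubPath (hz γ) h.length_le).2 h
        simp [Set.indicator, this, h]
      · simp [Set.indicator, h]
    · by_cases h : B.IsSubPath η γ
      · by_cases h' : z γ ∈ B.cylinder η <;> simp [Set.indicator, h, h']
      · by_cases h'' : γ.1 < η.1
        · by_cases h' : z γ ∈ B.cylinder η <;> simp [Set.indicator, h', h'']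
        · have : z γ ∉ B.cylinder η := fun h3 => h
            ((InfinitePath.mem_cylinder_iff_isSubPath (hz γ) (not_lt.1 h'')).1 h3)
          simp [Set.indicator, this]
  refine tendsto_of_tendsto_of_tendsto_of_le_of_le (hc η) ?_ (fun s => (hle s).1)
    fun s => (hle s).2
  have := (hc η).add (tendsto_finsetSum hS.toFinset fun γ _ => h0 γ)
  simpa using this

/-- The values `c` are the cylinder masses of a probability measure, which is the limit of
the measures `pointMeasure w z s`. -/
theorem exists_tendsto_pointMeasure [l.NeBot] (hcyl : ∀ γ, (B.cylinder γ).Nonempty)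
    (hpos : ∀ s, B.pathSum w s ≠ 0) (hfin : ∀ᶠ s in l, B.pathSum w s ≠ ∞)
    (h0 : ∀ γ, Tendsto (fun s : ℝ => ENNReal.ofReal (w γ ^ s) / B.pathSum w s) l (𝓝 0))
    (hc : ∀ γ, Tendsto (fun s => B.extensionSum w γ s / B.pathSum w s) l (𝓝 (c γ))) :
    ∃ P : Measure B.InfinitePath, IsProbabilityMeasure P ∧ (∀ γ, P (B.cylinder γ) = c γ) ∧
      ∀ z : B.FinitePath → B.InfinitePath, (∀ γ, z γ ∈ B.cylinder γ) →
        ∀ f : B.InfinitePath → ℂ, Continuous f →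
          Tendsto (fun s => ∫ x, f x ∂(pointMeasure w z s)) l (𝓝 (∫ x, f x ∂P)) := by
  classical
  choose z₀ hz₀ using hcyl
  obtain ⟨s₀, hs₀⟩ := hfin.exists
  -- Where the sum is infinite, the measure at `s₀` serves as a default; this happens only off an
  -- event of `l`.
  let pm (z : B.FinitePath → B.InfinitePath) (s : ℝ) : ProbabilityMeasure B.InfinitePath :=
    if h : B.pathSum w s ≠ ∞ then ⟨_, isProbabilityMeasure_pointMeasure (z := z) (hpos s) h⟩
    else ⟨_, isProbabilityMeasure_pointMeasure (z := z) (hpos s₀) hs₀⟩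
  have hpm : ∀ z, ∀ᶠ s in l, (pm z s : Measure B.InfinitePath) = pointMeasure w z s := by
    intro z
    filter_upwards [hfin] with s hs
    exact congrArg Subtype.val (dif_pos hs)
  -- Probability measures on a compact space form a compact space, so limits along ultrafilters
  -- exist; the clopen cylinders identify their values.
  have key : ∀ z : B.FinitePath → B.InfinitePath, (∀ γ, z γ ∈ B.cylinder γ) →
      ∀ U : Ultrafilter ℝ, (U : Filter ℝ) ≤ l → ∃ Q : ProbabilityMeasure B.InfinitePath,
        Tendsto (pm z) U (𝓝 Q) ∧ ∀ γ, (Q : Measure B.InfinitePath) (B.cylinder γ) = c γ := by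
    intro z hz U hU
    have hlim : Tendsto (pm z) U (𝓝 (U.map (pm z)).lim) := (U.map (pm z)).le_nhds_lim
    refine ⟨_, hlim, fun γ => ?_⟩
    have h1 := ProbabilityMeasure.tendsto_measure_of_null_frontier_of_tendsto' hlim
      (E := B.cylinder γ) (by simp [(InfinitePath.isClopen_cylinder γ).frontier_eq])
    refine tendsto_nhds_unique h1 (Tendsto.congr' ?_
      ((tendsto_pointMeasure_cylinder hz h0 hc γ).mono_left hU))
    filter_upwards [hU (hpm z)] with s hs
    exact congrArg (fun μ : Measure B.InfinitePath => μ (B.cylinder γ)) (Eq.symm hs)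
  obtain ⟨P, -, hP⟩ := key z₀ hz₀ (Ultrafilter.of l) (Ultrafilter.of_le l)
  refine ⟨P, inferInstance, hP, fun z hz f hf => ?_⟩
  -- Cylinder masses determine the limit, so it depends neither on the ultrafilter nor on `z`.
  have hlim : Tendsto (pm z) l (𝓝 P) := by
    rw [tendsto_iff_ultrafilter]
    intro U hU
    obtain ⟨Q, hQ, hQ'⟩ := key z hz U hU
    have := Q.2
    have : Q = P := Subtype.ext
      (InfinitePath.measure_ext fun γ => (hQ' γ).trans (hP γ).symm)
    exact this ▸ hQ
  have h1 := (ProbabilityMeasure.tendsto_iff_forall_integral_rclike_tendsto ℂ).1 hlim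
    (BoundedContinuousFunction.mkOfCompact ⟨f, hf⟩)
  refine Tendsto.congr' ?_ h1
  filter_upwards [hpm z] with s hs
  rw [hs]; rfl

theorem summable_of_pathSum_ne_top (hw : ∀ γ, 0 < w γ) {s : ℝ} (h : B.pathSum w s ≠ ∞) :
    Summable fun γ => w γ ^ s := by
  have := ENNReal.summable_toReal h
  refine this.congr fun γ => ?_
  rw [ENNReal.toReal_ofReal (Real.rpow_nonneg (hw γ).le s)]

theorem toReal_pathSum (hw : ∀ γ, 0 < w γ) (s : ℝ) :
    (B.pathSum w s).toReal = ∑' γ, w γ ^ s := by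
  rw [pathSum, ENNReal.tsum_toReal_eq fun _ => ENNReal.ofReal_ne_top]
  exact tsum_congr fun γ => ENNReal.toReal_ofReal (Real.rpow_nonneg (hw γ).le s)

theorem exists_norm_le_of_continuous {f : B.InfinitePath → ℂ} (hf : Continuous f) :
    ∃ C, ∀ x, ‖f x‖ ≤ C := by
  obtain ⟨C, hC⟩ := isCompact_univ.exists_bound_of_continuousOn (f := f) hf.continuousOn
  exact ⟨C, fun x => hC x (Set.mem_univ x)⟩

theorem summable_rpow_mul (hw : ∀ γ, 0 < w γ) {s : ℝ} (h : B.pathSum w s ≠ ∞)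
    {f : B.InfinitePath → ℂ} (hf : Continuous f) :
    Summable fun γ => ((w γ ^ s : ℝ) : ℂ) * f (z γ) := by
  obtain ⟨C, hC⟩ := exists_norm_le_of_continuous hf
  refine Summable.of_norm_bounded ((summable_of_pathSum_ne_top hw h).mul_right C) fun γ => ?_
  rw [norm_mul, Complex.norm_real, Real.norm_of_nonneg (Real.rpow_nonneg (hw γ).le s)]
  exact mul_le_mul_of_nonneg_left (hC _) (Real.rpow_nonneg (hw γ).le s)

theorem integral_pointMeasure (hw : ∀ γ, 0 < w γ) {s : ℝ} (h0 : B.pathSum w s ≠ 0)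
    (h : B.pathSum w s ≠ ∞) {f : B.InfinitePath → ℂ} (hf : Continuous f) :
    ∫ x, f x ∂(pointMeasure w z s) =
      (∑' γ, ((w γ ^ s : ℝ) : ℂ) * f (z γ)) / ((∑' γ, w γ ^ s : ℝ) : ℂ) := by
  have := isProbabilityMeasure_pointMeasure (z := z) h0 h
  obtain ⟨C, hC⟩ := exists_norm_le_of_continuous hf
  have hint : Integrable f (Measure.sum fun γ =>
      ENNReal.ofReal (w γ ^ s) • Measure.dirac (z γ)) := by
    have h1 : Integrable f (pointMeasure w z s) :=
      Integrable.of_bound hf.aestronglyMeasurable C (Eventually.of_forall hC)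
    exact (integrable_smul_measure (ENNReal.inv_ne_zero.2 h) (ENNReal.inv_ne_top.2 h0)).1 h1
  rw [pointMeasure, integral_smul_measure, integral_sum_measure hint, ENNReal.toReal_inv,
    toReal_pathSum hw, Complex.real_smul, Complex.ofReal_inv, ← div_eq_inv_mul]
  congr 1
  refine tsum_congr fun γ => ?_
  rw [integral_smul_measure, integral_dirac' _ _ hf.stronglyMeasurable,
    ENNReal.toReal_ofReal (Real.rpow_nonneg (hw γ).le s), Complex.real_smul]

end

end BratteliDiagram

/-! ### Perron-Frobenius theory for a single matrix. -/

section PositiveMatrix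

variable {ι : Type u} [Fintype ι]

/-- Perron's theorem: a matrix with positive entries has a positive eigenvector, and the
corresponding eigenspace is one-dimensional. -/
theorem Matrix.exists_pos_eigenvector [Nonempty ι] (P : Matrix ι ι ℝ) (hP : ∀ a b, 0 < P a b) :
    ∃ (x : ι → ℝ) (r : ℝ), (∀ a, 0 < x a) ∧ ∑ a, x a = 1 ∧ P.mulVec x = r • x ∧
      ∀ y, P.mulVec y = r • y → ∃ c : ℝ, y = c • x := by
  -- Collatz-Wielandt: maximize `r` subject to `r x ≤ P x` on the simplex. Coordinates there are at
  -- most one, so the sum `M` of all entries bounds `r` and the admissible set is compact.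
  set M : ℝ := ∑ a, ∑ b, P a b with hM
  let K : Set (ℝ × (ι → ℝ)) :=
    (Set.Icc 0 M ×ˢ stdSimplex ℝ ι) ∩ {q | ∀ a, q.1 * q.2 a ≤ P.mulVec q.2 a}
  have hmulc : ∀ a, Continuous fun x : ι → ℝ => P.mulVec x a := fun a => by
    simp only [Matrix.mulVec, dotProduct]; fun_prop
  have hK : IsCompact K := by
    refine (isCompact_Icc.prod (isCompact_stdSimplex ℝ ι)).inter_right ?_
    simp only [Set.ofPred_forall]
    refine isClosed_iInter fun a => isClosed_le (by fun_prop) ((hmulc a).comp continuous_snd)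
  have hMpos : 0 ≤ M := Finset.sum_nonneg fun a _ => Finset.sum_nonneg fun b _ => (hP a b).le
  have hmul_nonneg : ∀ x : ι → ℝ, (∀ a, 0 ≤ x a) → ∀ a, 0 ≤ P.mulVec x a := fun x hx a =>
    Finset.sum_nonneg fun b _ => mul_nonneg (hP a b).le (hx b)
  have hmul_pos : ∀ x : ι → ℝ, (∀ a, 0 ≤ x a) → x ≠ 0 → ∀ a, 0 < P.mulVec x a := by
    intro x hx hx0 a
    obtain ⟨b, hb⟩ := Function.ne_iff.1 hx0
    exact Finset.sum_pos' (fun b _ => mul_nonneg (hP a b).le (hx b))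
      ⟨b, Finset.mem_univ b, mul_pos (hP a b) ((hx b).lt_of_ne' hb)⟩
  have hbound : ∀ (r : ℝ) (x : ι → ℝ), x ∈ stdSimplex ℝ ι → (∀ a, r * x a ≤ P.mulVec x a) →
      r ≤ M := by
    intro r x hx h
    calc r = ∑ a, r * x a := by rw [← Finset.mul_sum, hx.2, mul_one]
      _ ≤ ∑ a, P.mulVec x a := Finset.sum_le_sum fun a _ => h a
      _ ≤ M := by
        refine Finset.sum_le_sum fun a _ => Finset.sum_le_sum fun b _ => ?_
        refine mul_le_of_le_one_right (hP a b).le ?_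
        rw [← hx.2]
        exact Finset.single_le_sum (fun i _ => hx.1 i) (Finset.mem_univ b)
  have hne : K.Nonempty := by
    classical
    obtain ⟨x, hx⟩ : (stdSimplex ℝ ι).Nonempty :=
      ⟨_, single_mem_stdSimplex ℝ (Classical.arbitrary ι)⟩
    refine ⟨(0, x), ⟨⟨le_rfl, hMpos⟩, hx⟩, fun a => ?_⟩
    simpa using hmul_nonneg x hx.1 a
  obtain ⟨⟨r, x⟩, ⟨⟨hr, hx⟩, hrx⟩, hmax⟩ := hK.exists_isMaxOn hne continuous_fst.continuousOn
  simp only at hr hx hrx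
  have hx0 : x ≠ 0 := by
    rintro rfl
    simpa using hx.2
  -- If `P x - r x` is nonzero, applying `P` makes the inequality strict in every coordinate for `y
  -- = P x`; then `r + ε` is admissible, against maximality.
  have heig : P.mulVec x = r • x := by
    by_contra hcon
    set y := P.mulVec x with hy
    have hypos : ∀ a, 0 < y a := hmul_pos x hx.1 hx0
    have hstrict : ∀ a, r * y a < P.mulVec y a := by
      intro a
      have h1 := hmul_pos (y - r • x) (fun b => by simpa using hrx b) (sub_ne_zero.2 hcon) a
      rw [Matrix.mulVec_sub, Matrix.mulVec_smul, ← hy] at h1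
      simpa using h1
    have hev : ∀ᶠ ε in 𝓝[>] (0 : ℝ), ∀ a, (r + ε) * y a < P.mulVec y a := by
      rw [eventually_all]
      intro a
      have : Tendsto (fun ε => (r + ε) * y a) (𝓝[>] (0 : ℝ)) (𝓝 ((r + 0) * y a)) :=
        Tendsto.mono_left (Continuous.tendsto (by fun_prop) _) nhdsWithin_le_nhds
      exact this.eventually_lt_const (by simpa using hstrict a)
    obtain ⟨ε, hε, hε0⟩ := (hev.and self_mem_nhdsWithin).exists
    set σ := ∑ a, y a with hσ
    have hσpos : 0 < σ := Finset.sum_pos (fun a _ => hypos a) Finset.univ_nonempty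
    have hmem : σ⁻¹ • y ∈ stdSimplex ℝ ι := by
      refine ⟨fun a => mul_nonneg (inv_nonneg.2 hσpos.le) (hypos a).le, ?_⟩
      simp only [Pi.smul_apply, smul_eq_mul]
      rw [← Finset.mul_sum, inv_mul_cancel₀ hσpos.ne']
    have hadm : ∀ a, (r + ε) * (σ⁻¹ • y) a ≤ P.mulVec (σ⁻¹ • y) a := by
      intro a
      rw [Matrix.mulVec_smul]
      have := mul_le_mul_of_nonneg_left (hε a).le (inv_nonneg.2 hσpos.le)
      simp only [Pi.smul_apply, smul_eq_mul]
      linarith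
    have h1 := hmax (a := (r + ε, σ⁻¹ • y))
      ⟨⟨⟨add_nonneg hr.1 (le_of_lt hε0), hbound _ _ hmem hadm⟩, hmem⟩, hadm⟩
    have h2 : r + ε ≤ r := h1
    have h3 : (0 : ℝ) < ε := hε0
    linarith
  have hxpos : ∀ a, 0 < x a := by
    intro a
    refine (hx.1 a).lt_of_ne' fun h => ?_
    have := hmul_pos x hx.1 hx0 a
    rw [heig] at this
    simp [h] at this
  refine ⟨x, r, hxpos, hx.2, heig, fun y hy => ?_⟩
  -- The largest multiple of `x` below `y` touches `y` at `a`. A nonzero difference would have an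
  -- image under `P` that is positive at `a`, but this image vanishes there.
  obtain ⟨a, ha⟩ := Finite.exists_min fun a => y a / x a
  refine ⟨y a / x a, ?_⟩
  by_contra hne
  have h1 := hmul_pos (y - (y a / x a) • x) (fun b => ?_) (sub_ne_zero.2 hne) a
  · rw [Matrix.mulVec_sub, Matrix.mulVec_smul, hy, heig] at h1
    have h2 := (hxpos a).ne'
    simp only [Pi.sub_apply, Pi.smul_apply, smul_eq_mul] at h1
    have h3 : y a / x a * (r * x a) = r * y a := by field_simp
    rw [h3] at h1
    linarith
  · have := (le_div_iff₀ (hxpos b)).1 (ha b)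
    simpa using this

/-- In the weighted norm `max ‖v a‖ / x a` the matrix has norm at most `c`, so no eigenvalue exceeds
`c` in modulus, while `c` is itself an eigenvalue. -/
theorem natSpectralRadius_eq [DecidableEq ι] [Nonempty ι] {M : Matrix ι ι ℕ} {x : ι → ℝ} {c : ℝ}
    (hx : ∀ a, 0 < x a) (h : (M.map (Nat.cast : ℕ → ℝ)).mulVec x = c • x) :
    natSpectralRadius M = c := by
  have hcx : ∀ a, ∑ b, (M a b : ℝ) * x b = c * x a := fun a => by
    simpa [Matrix.mulVec, dotProduct] using congrFun h a
  have hc : 0 ≤ c := by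
    obtain ⟨a⟩ := ‹Nonempty ι›
    refine nonneg_of_mul_nonneg_left ?_ (hx a)
    rw [← hcx a]
    exact Finset.sum_nonneg fun b _ => mul_nonneg (Nat.cast_nonneg _) (hx b).le
  have hspec : ∀ μ : ℂ, μ ∈ spectrum ℂ (M.map (Nat.cast : ℕ → ℂ)) ↔
      ∃ v : ι → ℂ, v ≠ 0 ∧ (M.map (Nat.cast : ℕ → ℂ)).mulVec v = μ • v := by
    intro μ
    rw [← Matrix.spectrum_toLin', ← Module.End.hasEigenvalue_iff_mem_spectrum]
    constructor
    · intro h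
      obtain ⟨v, hv⟩ := h.exists_hasEigenvector
      exact ⟨v, hv.2, by simpa using hv.apply_eq_smul⟩
    · rintro ⟨v, h0, hv⟩
      exact Module.End.hasEigenvalue_of_hasEigenvector
        ⟨Module.End.mem_eigenspace_iff.2 (by simpa using hv), h0⟩
  have hrad : spectralRadius ℂ (M.map (Nat.cast : ℕ → ℂ)) = ENNReal.ofReal c := by
    refine le_antisymm (iSup₂_le fun μ hμ => ?_) ?_
    · obtain ⟨v, hv0, hv⟩ := (hspec μ).1 hμ
      obtain ⟨a, ha⟩ := Finite.exists_max fun a => ‖v a‖ / x a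
      set C := ‖v a‖ / x a with hC
      have hva : ‖v a‖ = C * x a := by rw [hC, div_mul_cancel₀ _ (hx a).ne']
      have hvb : ∀ b, ‖v b‖ ≤ C * x b := fun b => (div_le_iff₀ (hx b)).1 (ha b)
      have hCpos : 0 < C := by
        obtain ⟨b, hb⟩ := Function.ne_iff.1 hv0
        exact (div_pos (norm_pos_iff.2 hb) (hx b)).trans_le (ha b)
      have h1 : ‖μ‖ * (C * x a) ≤ c * (C * x a) := by
        calc ‖μ‖ * (C * x a) = ‖∑ b, (M a b : ℂ) * v b‖ := by
              rw [← hva, ← norm_mul]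
              have := congrFun hv a
              simp only [Matrix.mulVec, dotProduct, Matrix.map_apply, Pi.smul_apply,
                smul_eq_mul] at this
              rw [this]
          _ ≤ ∑ b, (M a b : ℝ) * (C * x b) := by
              refine (norm_sum_le _ _).trans (Finset.sum_le_sum fun b _ => ?_)
              rw [norm_mul, Complex.norm_natCast]
              exact mul_le_mul_of_nonneg_left (hvb b) (Nat.cast_nonneg _)
          _ = C * ∑ b, (M a b : ℝ) * x b := by
              rw [Finset.mul_sum]
              exact Finset.sum_congr rfl fun b _ => by ring
          _ = c * (C * x a) := by rw [hcx]; ring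
      have h2 := le_of_mul_le_mul_right h1 (mul_pos hCpos (hx a))
      rw [← enorm_eq_nnnorm, ← ofReal_norm]
      exact ENNReal.ofReal_le_ofReal h2
    · have hmem : (c : ℂ) ∈ spectrum ℂ (M.map (Nat.cast : ℕ → ℂ)) := by
        refine (hspec _).2 ⟨fun a => (x a : ℂ), ?_, ?_⟩
        · obtain ⟨a⟩ := ‹Nonempty ι›
          exact Function.ne_iff.2 ⟨a, by simpa using (hx a).ne'⟩
        · funext a
          simp only [Matrix.mulVec, dotProduct, Matrix.map_apply, Pi.smul_apply, smul_eq_mul]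
          exact_mod_cast hcx a
      refine le_trans (le_of_eq ?_) (le_iSup₂ (f := fun (μ : ℂ) (_ : μ ∈ spectrum ℂ
        (M.map (Nat.cast : ℕ → ℂ))) => (‖μ‖₊ : ℝ≥0∞)) (c : ℂ) hmem)
      rw [← enorm_eq_nnnorm, ← ofReal_norm, Complex.norm_real, Real.norm_of_nonneg hc]
  rw [natSpectralRadius, hrad, ENNReal.toReal_ofReal hc]

end PositiveMatrix

/-! ### The common eigenvector of a higher-rank graph. -/

namespace KGraph

variable {k : ℕ} {Λ : Type u} [Category.{v} Λ]

/-- The number of morphisms of degree `n` with given range and source. -/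
noncomputable def count (G : KGraph k Λ) (n : Fin k → ℕ) : Matrix Λ Λ ℕ :=
  fun a b => Nat.card {f : b ⟶ a // G.d f = n}

variable {G : KGraph k Λ}

theorem IsFinite.finite_hom (hfin : G.IsFinite) (n : Fin k → ℕ) (a b : Λ) :
    Finite {f : b ⟶ a // G.d f = n} := by
  have := hfin n
  refine Finite.of_injective (fun f => (⟨⟨b, a, f.1⟩, f.2⟩ :
    {f : Σ (a : Λ) (b : Λ), (a ⟶ b) // G.d f.2.2 = n})) fun f g h => ?_
  simpa [Subtype.ext_iff] using h

/-- Composition of morphisms of degrees `m` and `n` is bijective onto degree `m + n` by the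
factorization property. In particular the count matrices commute. -/
theorem count_mul [Fintype Λ] (hfin : G.IsFinite) (m n : Fin k → ℕ) :
    G.count m * G.count n = G.count (m + n) := by
  have := fun n a b => hfin.finite_hom n a b
  ext a b
  rw [Matrix.mul_apply]
  let F : (Σ c : Λ, {f : c ⟶ a // G.d f = m} × {f : b ⟶ c // G.d f = n}) →
      {f : b ⟶ a // G.d f = m + n} := fun p =>
    ⟨p.2.2.1 ≫ p.2.1.1, by rw [G.d_comp, p.2.1.2, p.2.2.2, add_comm]⟩
  have hF : Function.Bijective F := by
    constructor
    · rintro ⟨c, ⟨f, hf⟩, ⟨g, hg⟩⟩ ⟨c', ⟨f', hf'⟩, ⟨g', hg'⟩⟩ h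
      have h' : g ≫ f = g' ≫ f' := congrArg Subtype.val h
      have := (G.factorization (g ≫ f) m n
        (by rw [G.d_comp, hf, hg, add_comm])).unique (y₁ := ⟨c, f, g⟩) (y₂ := ⟨c', f', g'⟩)
        ⟨hf, hg, rfl⟩ ⟨hf', hg', h'.symm⟩
      cases this
      rfl
    · rintro ⟨f, hf⟩
      obtain ⟨⟨c, g, h⟩, ⟨h1, h2, h3⟩, -⟩ := G.factorization f m n hf
      exact ⟨⟨c, ⟨g, h1⟩, ⟨h, h2⟩⟩, Subtype.ext h3⟩
  rw [count, ← Nat.card_congr (Equiv.ofBijective F hF), Nat.card_sigma]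
  simp only [Nat.card_prod, count]

/-- The adjacency matrices of a finite strongly connected `k`-graph have a common
Perron-Frobenius eigenvector. -/
theorem exists_isPerronFrobenius [Fintype Λ] [DecidableEq Λ] [Nonempty Λ] (hfin : G.IsFinite)
    (hconn : G.IsStronglyConnected) : ∃ x, IsPerronFrobenius G.adjacency x := by
  let R (n : Fin k → ℕ) : Matrix Λ Λ ℝ := (G.count n).map (Nat.cast : ℕ → ℝ)
  have hcomm : ∀ m n, Commute (R m) (R n) := by
    intro m n
    have h1 : ∀ m n, R m * R n = R (m + n) := fun m n => by
      simp only [R, ← count_mul hfin]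
      exact ((G.count m).map_mul (f := Nat.castRingHom ℝ)).symm
    rw [Commute, SemiconjBy, h1, h1, add_comm]
  let f (a b : Λ) : b ⟶ a := (hconn a b).some
  -- Strong connectivity gives a morphism for each pair of vertices; summing the count matrices of
  -- their degrees gives a matrix with positive entries.
  let P : Matrix Λ Λ ℝ := ∑ q : Λ × Λ, R (G.d (f q.1 q.2))
  have hP : ∀ a b, 0 < P a b := by
    intro a b
    simp only [P, Matrix.sum_apply]
    refine Finset.sum_pos' (fun q _ => Nat.cast_nonneg _) ⟨(a, b), Finset.mem_univ _, ?_⟩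
    have := hfin.finite_hom (G.d (f a b)) a b
    have : Nonempty {g : b ⟶ a // G.d g = G.d (f a b)} := ⟨⟨f a b, rfl⟩⟩
    exact Nat.cast_pos.2 Nat.card_pos
  obtain ⟨x, r, hx, hsum, heig, huniq⟩ := P.exists_pos_eigenvector hP
  refine ⟨x, hx, hsum, fun i => ?_⟩
  -- Each adjacency matrix commutes with `P`, so it preserves the one-dimensional Perron eigenspace.
  have hPi : Commute P (R (Pi.single i 1)) := Commute.sum_left _ _ _ fun q _ => hcomm _ _
  obtain ⟨c, hc⟩ := huniq ((R (Pi.single i 1)).mulVec x) (by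
    rw [Matrix.mulVec_mulVec, hPi.eq, ← Matrix.mulVec_mulVec, heig, Matrix.mulVec_smul])
  have hc' : ((G.adjacency i).map (Nat.cast : ℕ → ℝ)).mulVec x = c • x := hc
  rw [natSpectralRadius_eq hx hc', hc']

theorem isPerronFrobenius_perronFrobenius [Fintype Λ] [DecidableEq Λ] [Nonempty Λ]
    (hfin : G.IsFinite) (hconn : G.IsStronglyConnected) :
    IsPerronFrobenius G.adjacency (perronFrobenius G.adjacency) := by
  have h := exists_isPerronFrobenius hfin hconn
  rw [perronFrobenius, dif_pos h]
  exact h.choose_spec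

end KGraph

/-! ### Abel means of a positive operator with a positive fixed vector -/

section AbelMeans

variable {J : Type u} [Fintype J] {T : Module.End ℝ (J → ℝ)} {z : J → ℝ}

-- A positive operator fixing `z` preserves the order interval from `-C z` to `C z`. Thus `T` is
-- power bounded, the only analytic input on `T`.
omit [Fintype J] in
theorem abs_pow_apply_le (hT : ∀ y, 0 ≤ y → 0 ≤ T y) (hz : T z = z) {y : J → ℝ} {C : ℝ}
    (hy : ∀ p, |y p| ≤ C * z p) (j : ℕ) (p : J) : |(T ^ j) y p| ≤ C * z p := by
  induction j generalizing p with
  | zero => simpa using hy p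
  | succ j ih =>
    rw [pow_succ', Module.End.mul_apply]
    set v := (T ^ j) y
    have h1 := hT (C • z - v) (fun p => by simpa using (abs_le.1 (ih p)).2) p
    have h2 := hT (C • z + v) (fun p => by
      have := (abs_le.1 (ih p)).1
      simp only [Pi.zero_apply, Pi.add_apply, Pi.smul_apply, smul_eq_mul]; linarith) p
    simp only [map_sub, map_add, map_smul, hz, Pi.zero_apply, Pi.add_apply, Pi.sub_apply,
      Pi.smul_apply, smul_eq_mul] at h1 h2
    exact abs_le.2 ⟨by linarith, by linarith⟩

omit [Fintype J] in
theorem le_pow_apply (hT : ∀ y, 0 ≤ y → 0 ≤ T y) (hz : T z = z) {y : J → ℝ} {c : ℝ}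
    (hy : ∀ p, c * z p ≤ y p) (j : ℕ) (p : J) : c * z p ≤ (T ^ j) y p := by
  induction j generalizing p with
  | zero => simpa using hy p
  | succ j ih =>
    rw [pow_succ', Module.End.mul_apply]
    have h1 := hT ((T ^ j) y - c • z) (fun p => by simpa using ih p) p
    simpa [map_sub, hz] using h1

theorem exists_abs_le_mul (hpos : ∀ p, 0 < z p) (y : J → ℝ) :
    ∀ p, |y p| ≤ (∑ q, |y q| / z q) * z p := fun p => by
  rw [← div_le_iff₀ (hpos p)]
  exact Finset.single_le_sum (f := fun q => |y q| / z q)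
    (fun q _ => div_nonneg (abs_nonneg _) (hpos q).le) (Finset.mem_univ p)

theorem summable_abel (hT : ∀ y, 0 ≤ y → 0 ≤ T y) (hz : T z = z) (hpos : ∀ p, 0 < z p)
    (y : J → ℝ) (p : J) {r : ℝ} (hr0 : 0 ≤ r) (hr1 : r < 1) :
    Summable fun j : ℕ => r ^ j * (T ^ j) y p := by
  refine Summable.of_norm_bounded ((summable_geometric_of_lt_one hr0 hr1).mul_right
    ((∑ q, |y q| / z q) * z p)) fun j => ?_
  rw [norm_mul, Real.norm_of_nonneg (pow_nonneg hr0 j)]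
  exact mul_le_mul_of_nonneg_left (abs_pow_apply_le hT hz (exists_abs_le_mul hpos y) j p)
    (pow_nonneg hr0 j)

omit [Fintype J] in
theorem abs_abel_le (hT : ∀ y, 0 ≤ y → 0 ≤ T y) (hz : T z = z) {y : J → ℝ} {C : ℝ}
    (hy : ∀ p, |y p| ≤ C * z p) (p : J) {r : ℝ} (hr0 : 0 ≤ r) (hr1 : r < 1) :
    |(1 - r) * ∑' j : ℕ, r ^ j * (T ^ j) y p| ≤ C * z p := by
  have h1 : 0 < 1 - r := sub_pos.2 hr1
  have h2 : ‖∑' j : ℕ, r ^ j * (T ^ j) y p‖ ≤ (1 - r)⁻¹ * (C * z p) := by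
    refine tsum_of_norm_bounded ((hasSum_geometric_of_lt_one hr0 hr1).mul_right (C * z p))
      fun j => ?_
    rw [norm_mul, Real.norm_of_nonneg (pow_nonneg hr0 j)]
    exact mul_le_mul_of_nonneg_left (abs_pow_apply_le hT hz hy j p) (pow_nonneg hr0 j)
  rw [abs_mul, abs_of_pos h1]
  calc (1 - r) * |∑' j : ℕ, r ^ j * (T ^ j) y p|
      ≤ (1 - r) * ((1 - r)⁻¹ * (C * z p)) := mul_le_mul_of_nonneg_left h2 h1.le
    _ = C * z p := by rw [← mul_assoc, mul_inv_cancel₀ h1.ne', one_mul]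

theorem le_abel (hT : ∀ y, 0 ≤ y → 0 ≤ T y) (hz : T z = z) (hpos : ∀ p, 0 < z p)
    {y : J → ℝ} {c : ℝ} (hy : ∀ p, c * z p ≤ y p) (p : J) {r : ℝ} (hr0 : 0 ≤ r) (hr1 : r < 1) :
    c * z p ≤ (1 - r) * ∑' j : ℕ, r ^ j * (T ^ j) y p := by
  have h1 : 0 < 1 - r := sub_pos.2 hr1
  have h2 : (1 - r)⁻¹ * (c * z p) ≤ ∑' j : ℕ, r ^ j * (T ^ j) y p := by
    rw [← tsum_geometric_of_lt_one hr0 hr1, ← tsum_mul_right]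
    exact Summable.tsum_le_tsum
      (fun j => mul_le_mul_of_nonneg_left (le_pow_apply hT hz hy j p) (pow_nonneg hr0 j))
      ((summable_geometric_of_lt_one hr0 hr1).mul_right _) (summable_abel hT hz hpos y p hr0 hr1)
  calc c * z p = (1 - r) * ((1 - r)⁻¹ * (c * z p)) := by
        rw [← mul_assoc, mul_inv_cancel₀ h1.ne', one_mul]
    _ ≤ _ := mul_le_mul_of_nonneg_left h2 h1.le

/-- If `w = (1 - T) v` is fixed by `T`, then `T ^ j v = v - j w`, which stays bounded only for `w =
0`. Rank-nullity does the rest. -/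
theorem isCompl_ker_range (hT : ∀ y, 0 ≤ y → 0 ≤ T y) (hz : T z = z) (hpos : ∀ p, 0 < z p) :
    IsCompl (LinearMap.ker (1 - T)) (LinearMap.range (1 - T)) := by
  refine (Submodule.isCompl_iff_disjoint _ _ ?_).2 ?_
  · rw [add_comm, LinearMap.finrank_range_add_finrank_ker]
  · rw [Submodule.disjoint_def]
    rintro w hw ⟨v, rfl⟩
    set w := (1 - T) v with hw'
    have hTw : T w = w := by
      have h : w - T w = 0 := by simpa using hw
      exact (sub_eq_zero.1 h).symm
    have hTv : T v = v - w := by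
      have h : w = v - T v := by rw [hw']; simp
      rw [h]; abel
    have hpow : ∀ j : ℕ, (T ^ j) v = v - (j : ℝ) • w := by
      intro j
      induction j with
      | zero => simp
      | succ j ih =>
        rw [pow_succ', Module.End.mul_apply, ih, map_sub, map_smul, hTw, hTv]
        push_cast
        rw [add_smul, one_smul]; abel
    funext p
    by_contra hne
    have hne' : 0 < |w p| := abs_pos.2 hne
    set C := ∑ q, |v q| / z q
    obtain ⟨j, hj⟩ := exists_nat_gt ((|v p| + C * z p) / |w p|)
    rw [div_lt_iff₀ hne'] at hj
    have h1 := abs_pow_apply_le hT hz (exists_abs_le_mul hpos v) j p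
    rw [hpow j] at h1
    have h2 : |(j : ℝ) * w p| ≤ |v p| + |v p - (j : ℝ) * w p| := by
      have := abs_sub (v p) (v p - (j : ℝ) * w p)
      simpa using this
    rw [abs_mul, Nat.abs_cast] at h2
    simp only [Pi.sub_apply, Pi.smul_apply, smul_eq_mul] at h1
    linarith

/-- The Abel means are constant on `ker (1 - T)`; on `(1 - T) v` the series telescopes and leaves a
term of order `1 - r`. -/
theorem exists_tendsto_abel (hT : ∀ y, 0 ≤ y → 0 ≤ T y) (hz : T z = z) (hpos : ∀ p, 0 < z p)
    (y : J → ℝ) : ∃ ybar : J → ℝ, ∀ p,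
      Tendsto (fun r : ℝ => (1 - r) * ∑' j : ℕ, r ^ j * (T ^ j) y p) (𝓝[<] 1) (𝓝 (ybar p)) := by
  obtain ⟨u, hu, w, ⟨v, rfl⟩, huv⟩ := Submodule.mem_sup.1
    ((isCompl_ker_range hT hz hpos).sup_eq_top ▸ Submodule.mem_top (x := y))
  have hTu : T u = u := by
    have h : u - T u = 0 := by simpa using hu
    exact (sub_eq_zero.1 h).symm
  have hpowu : ∀ j : ℕ, (T ^ j) u = u := fun j => by
    induction j with
    | zero => rfl
    | succ j ih => rw [pow_succ', Module.End.mul_apply, ih, hTu]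
  refine ⟨u, fun p => ?_⟩
  set C := ∑ q, |(T v) q| / z q
  have hev : ∀ᶠ r : ℝ in 𝓝[<] 1, 0 ≤ r ∧ r < 1 :=
    (eventually_nhdsWithin_of_eventually_nhds (eventually_ge_nhds one_pos)).and
      self_mem_nhdsWithin
  have hkey : ∀ᶠ r : ℝ in 𝓝[<] 1,
      ‖(1 - r) * (∑' j : ℕ, r ^ j * (T ^ j) y p) - u p‖ ≤ (1 - r) * (|v p| + C * z p) := by
    filter_upwards [hev] with r hr
    have hsv := summable_abel hT hz hpos v p hr.1 hr.2
    have hsv' := summable_abel hT hz hpos (T v) p hr.1 hr.2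
    set S' := ∑' j : ℕ, r ^ j * (T ^ j) (T v) p with hS'
    have hS : ∑' j : ℕ, r ^ j * (T ^ j) v p = v p + r * S' := by
      rw [hsv.tsum_eq_zero_add, hS', ← tsum_mul_left]
      congr 1
      · simp
      · refine tsum_congr fun j => ?_
        rw [pow_succ T, Module.End.mul_apply]; ring
    have hsum : ∑' j : ℕ, r ^ j * (T ^ j) y p = (1 - r)⁻¹ * u p + (v p + r * S' - S') := by
      rw [← hS, hS', ← Summable.tsum_sub hsv hsv', ← tsum_geometric_of_lt_one hr.1 hr.2,
        ← tsum_mul_right, ← Summable.tsum_add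
          ((summable_geometric_of_lt_one hr.1 hr.2).mul_right _) (hsv.sub hsv')]
      refine tsum_congr fun j => ?_
      rw [← huv, map_add, hpowu]
      simp only [LinearMap.sub_apply, Module.End.one_apply, map_sub, Pi.add_apply, Pi.sub_apply]
      ring
    have h1 : 0 < 1 - r := sub_pos.2 hr.2
    have h2 : (1 - r) * (∑' j : ℕ, r ^ j * (T ^ j) y p) - u p
        = (1 - r) * (v p - (1 - r) * S') := by
      rw [hsum, mul_add, ← mul_assoc, mul_inv_cancel₀ h1.ne']; ring
    rw [h2, norm_mul, Real.norm_of_nonneg h1.le]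
    refine mul_le_mul_of_nonneg_left ((norm_sub_le _ _).trans (add_le_add le_rfl ?_)) h1.le
    exact abs_abel_le hT hz (exists_abs_le_mul hpos (T v)) p hr.1 hr.2
  rw [tendsto_iff_norm_sub_tendsto_zero]
  refine squeeze_zero' (Eventually.of_forall fun _ => norm_nonneg _) hkey ?_
  have : Tendsto (fun r : ℝ => (1 - r) * (|v p| + C * z p)) (𝓝[<] 1)
      (𝓝 ((1 - 1) * (|v p| + C * z p))) :=
    (Continuous.tendsto (by fun_prop) _).mono_left nhdsWithin_le_nhds
  simpa using this

/-- The Abel means `(1 - r) ∑ r ^ j T ^ j y` converge as `r ↗ 1` while `y` converges, and the limit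
is positive if the limit of `y` is. -/
theorem exists_tendsto_abel_of_tendsto (hT : ∀ y, 0 ≤ y → 0 ≤ T y) (hz : T z = z)
    (hpos : ∀ p, 0 < z p) {l : Filter ℝ} {y : ℝ → J → ℝ} {y₀ : J → ℝ} (hy₀ : ∀ p, 0 < y₀ p)
    (hy : ∀ p, Tendsto (fun s => y s p) l (𝓝 (y₀ p))) {r : ℝ → ℝ} (hr : Tendsto r l (𝓝[<] 1)) :
    ∃ ybar : J → ℝ, (∀ p, 0 < ybar p) ∧ ∀ p,
      Tendsto (fun s => (1 - r s) * ∑' j : ℕ, r s ^ j * (T ^ j) (y s) p) l (𝓝 (ybar p)) := by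
  obtain ⟨ybar, hbar⟩ := exists_tendsto_abel hT hz hpos y₀
  have hev : ∀ᶠ r : ℝ in 𝓝[<] 1, 0 ≤ r ∧ r < 1 :=
    (eventually_nhdsWithin_of_eventually_nhds (eventually_ge_nhds one_pos)).and
      self_mem_nhdsWithin
  refine ⟨ybar, fun p => ?_, fun p => ?_⟩
  · have : Nonempty J := ⟨p⟩
    -- The bound `y₀ ≥ c z` passes to all Abel means, so `c z` bounds the limit from below.
    obtain ⟨q, hq⟩ := Finite.exists_min fun q => y₀ q / z q
    refine (mul_pos (div_pos (hy₀ q) (hpos q)) (hpos p)).trans_le (ge_of_tendsto (hbar p) ?_)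
    filter_upwards [hev] with r hr
    exact le_abel hT hz hpos (fun p => (le_div_iff₀ (hpos p)).1 (hq p)) p hr.1 hr.2
  · have h1 := (hbar p).comp hr
    -- Abel means do not increase the weighted sup norm, so replacing `y s` by `y₀` costs at most
    -- their weighted distance.
    have h2 : Tendsto (fun s => (1 - r s) * ∑' j : ℕ, r s ^ j * (T ^ j) (y s - y₀) p) l (𝓝 0) := by
      refine squeeze_zero_norm' (a := fun s => (∑ q, |y s q - y₀ q| / z q) * z p) ?_ ?_
      · filter_upwards [hr.eventually hev] with s hs
        exact abs_abel_le hT hz (exists_abs_le_mul hpos (y s - y₀)) p hs.1 hs.2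
      · have : Tendsto (fun s => (∑ q, |y s q - y₀ q| / z q) * z p) l
            (𝓝 ((∑ q, |y₀ q - y₀ q| / z q) * z p)) :=
          (tendsto_finsetSum _ fun q _ => (((hy q).sub_const _).abs).div_const _).mul_const _
        simpa using this
    have h3 := h2.add h1
    rw [zero_add] at h3
    refine h3.congr' ?_
    filter_upwards [hr.eventually hev] with s hs
    simp only [Function.comp]
    rw [← mul_add, ← Summable.tsum_add (summable_abel hT hz hpos _ p hs.1 hs.2)
      (summable_abel hT hz hpos _ p hs.1 hs.2)]
    congr 1
    refine tsum_congr fun j => ?_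
    rw [← mul_add, ← Pi.add_apply, ← map_add, sub_add_cancel]

end AbelMeans

/-! ### Sums over the paths of a given length. -/

namespace BratteliDiagram

section LevelSum

variable {B : BratteliDiagram.{u, v}} {Q : B.FinitePath → Prop}

open Classical in
/-- The sum of `g (s(η))` over the paths `η` of length `n` that satisfy `Q`. -/
noncomputable def levelSum (Q : B.FinitePath → Prop) (n : ℕ) (g : B.V n → ℝ≥0∞) : ℝ≥0∞ :=
  ∑' η : B.Level n, if Q ⟨n, η⟩ then g η.1 else 0

/-- Since `Q` ignores the last edge, that edge can be summed first. -/
theorem levelSum_succ {n : ℕ}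
    (hQ : ∀ p q (μ : B.PathTo n p) (e : B.E n p q), Q ⟨n + 1, q, μ.snoc e⟩ ↔ Q ⟨n, p, μ⟩)
    (g : B.V (n + 1) → ℝ≥0∞) :
    levelSum Q (n + 1) g = levelSum Q n fun p => ∑' q, ∑' _ : B.E n p q, g q := by
  classical
  simp only [levelSum]
  rw [ENNReal.tsum_sigma', ENNReal.tsum_sigma']
  have h1 : ∀ q : B.V (n + 1), (∑' η : B.PathTo (n + 1) q, if Q ⟨n + 1, q, η⟩ then g q else 0) =
      ∑' p : B.V n, ∑' μ : B.PathTo n p, ∑' _ : B.E n p q, if Q ⟨n, p, μ⟩ then g q else 0 := by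
    intro q
    rw [← (PathTo.succEquiv B n q).symm.tsum_eq, ENNReal.tsum_sigma']
    refine tsum_congr fun p => ?_
    rw [ENNReal.tsum_prod']
    refine tsum_congr fun μ => tsum_congr fun e => ?_
    exact if_congr (hQ p q μ e) rfl rfl
  simp_rw [h1]
  rw [ENNReal.tsum_comm]
  refine tsum_congr fun p => ?_
  rw [ENNReal.tsum_comm]
  refine tsum_congr fun μ => ?_
  by_cases h : Q ⟨n, p, μ⟩ <;> simp [h]

theorem tsum_ite_eq_tsum_levelSum (φ : (n : ℕ) → B.V n → ℝ≥0∞) [DecidablePred Q] :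
    (∑' γ : B.FinitePath, if Q γ then φ γ.1 γ.2.1 else 0) = ∑' n, levelSum Q n (φ n) := by
  rw [ENNReal.tsum_sigma']
  refine tsum_congr fun n => tsum_congr fun η => ?_
  congr

theorem levelSum_isSubPath_of_lt {γ : B.FinitePath} {n : ℕ} (h : n < γ.1) (g : B.V n → ℝ≥0∞) :
    levelSum (B.IsSubPath γ) n g = 0 := by
  rw [levelSum, ENNReal.tsum_eq_zero]
  exact fun η => if_neg fun h1 => absurd h1.length_le (by simpa using h)

theorem levelSum_isSubPath_self (γ : B.FinitePath) (g : B.V γ.1 → ℝ≥0∞) :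
    levelSum (B.IsSubPath γ) γ.1 g = g γ.2.1 := by
  obtain ⟨n, γ⟩ := γ
  rw [levelSum, tsum_eq_single γ]
  · exact if_pos .refl
  · intro η hη
    refine if_neg fun h => ?_
    have h2 := h.eq_of_length_le le_rfl
    cases h2
    exact hη rfl

theorem levelSum_true_zero (g : B.V 0 → ℝ≥0∞) :
    levelSum (fun _ : B.FinitePath => True) 0 g = ∑' p, g p := by
  let e : B.Level 0 ≃ B.V 0 :=
    ⟨fun η => η.1, fun p => ⟨p, .vertex p⟩, by rintro ⟨p, η⟩; cases η; rfl, fun _ => rfl⟩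
  simp only [levelSum, if_true]
  exact e.tsum_eq g

end LevelSum

end BratteliDiagram

/-! ### Weights of stationary diagrams -/

section LevelProd

variable {k : ℕ}

/-- The product `ρ₁^{q+1} ⋯ ρ_t^{q+1} ρ_{t+1}^q ⋯ ρ_k^q` for `n = q k + t`. -/
noncomputable def levelProd (ρ : Fin k → ℝ) (n : ℕ) : ℝ :=
  ∏ i : Fin k, ρ i ^ (if i.val < n % k then n / k + 1 else n / k)

theorem levelProd_zero (ρ : Fin k → ℝ) : levelProd ρ 0 = 1 := by simp [levelProd]

theorem levelProd_pos {ρ : Fin k → ℝ} (hρ : ∀ i, 0 < ρ i) (n : ℕ) : 0 < levelProd ρ n :=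
  Finset.prod_pos fun i _ => pow_pos (hρ i) _

theorem levelProd_succ [NeZero k] (ρ : Fin k → ℝ) (n : ℕ) :
    levelProd ρ (n + 1) = levelProd ρ n * ρ (Fin.ofNat k n) := by
  have hk : 0 < k := NeZero.pos k
  have h1 : ρ (Fin.ofNat k n) = ∏ i : Fin k, ρ i ^ (if i = Fin.ofNat k n then 1 else 0) := by
    simp
  rw [levelProd, levelProd, h1, ← Finset.prod_mul_distrib]
  refine Finset.prod_congr rfl fun i _ => ?_
  rw [← pow_add]
  congr 1
  have hi : (i = Fin.ofNat k n) ↔ i.val = n % k := by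
    rw [Fin.ext_iff]; rfl
  have hik := i.2
  have hlt := Nat.mod_lt n hk
  -- At the end of a period the remainder resets and the quotient grows; otherwise only the
  -- remainder moves.
  by_cases h : n % k + 1 = k
  · have h2 : (n + 1) % k = 0 := by
      rw [← Nat.mod_add_mod, h, Nat.mod_self]
    have h3 : (n + 1) / k = n / k + 1 := by
      rw [Nat.succ_div_of_dvd (Nat.dvd_of_mod_eq_zero h2)]
    rw [h2, h3]
    split_ifs <;> simp_all <;> omega
  · have h2 : (n + 1) % k = n % k + 1 := by
      rw [← Nat.mod_add_mod, Nat.mod_eq_of_lt (by omega)]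
    have h3 : (n + 1) / k = n / k := by
      rw [Nat.succ_div_of_not_dvd fun h4 => by
        have := Nat.mod_eq_zero_of_dvd h4; omega]
    rw [h2, h3]
    split_ifs <;> simp_all <;> omega

theorem levelProd_add_period [NeZero k] (ρ : Fin k → ℝ) (n : ℕ) :
    levelProd ρ (n + k) = (∏ i, ρ i) * levelProd ρ n := by
  rw [levelProd, levelProd, ← Finset.prod_mul_distrib]
  refine Finset.prod_congr rfl fun i _ => ?_
  rw [Nat.add_mod_right, Nat.add_div_right _ (NeZero.pos k), ← pow_succ']
  congr 1
  split_ifs <;> rfl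

/-- The geometric mean of the numbers `ρ i`. -/
noncomputable def growthRate (ρ : Fin k → ℝ) : ℝ := (∏ i, ρ i) ^ ((k : ℝ)⁻¹)

/-- The `k`-periodic factor of `levelProd`. -/
noncomputable def periodicFactor (ρ : Fin k → ℝ) (n : ℕ) : ℝ := levelProd ρ n / growthRate ρ ^ n

variable {ρ : Fin k → ℝ}

theorem growthRate_pos (hρ : ∀ i, 0 < ρ i) : 0 < growthRate ρ :=
  Real.rpow_pos_of_pos (Finset.prod_pos fun i _ => hρ i) _

theorem periodicFactor_pos (hρ : ∀ i, 0 < ρ i) (n : ℕ) : 0 < periodicFactor ρ n :=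
  div_pos (levelProd_pos hρ n) (pow_pos (growthRate_pos hρ) n)

theorem levelProd_eq (hρ : ∀ i, 0 < ρ i) (n : ℕ) :
    levelProd ρ n = growthRate ρ ^ n * periodicFactor ρ n := by
  rw [periodicFactor, mul_div_cancel₀ _ (pow_pos (growthRate_pos hρ) n).ne']

/-- Since `growthRate ρ ^ k = ∏ i, ρ i`, a full period cancels from the quotient. -/
theorem periodicFactor_ofNat [NeZero k] (hρ : ∀ i, 0 < ρ i) (n : ℕ) :
    periodicFactor ρ (Fin.ofNat k n).val = periodicFactor ρ n := by
  have hper : Function.Periodic (periodicFactor ρ) k := by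
    intro n
    have h1 : growthRate ρ ^ k = ∏ i, ρ i :=
      Real.rpow_inv_natCast_pow (Finset.prod_pos fun i _ => hρ i).le (NeZero.ne k)
    rw [periodicFactor, levelProd_add_period, pow_add, h1, mul_comm,
      mul_div_mul_right _ _ (Finset.prod_pos fun i _ => hρ i).ne', periodicFactor]
  exact hper.map_mod_nat n

end LevelProd

/-! ### The transfer operator and the path sums. -/

namespace BratteliDiagram

section Transfer

variable {k : ℕ} [NeZero k] {ι : Type u} [Fintype ι]

/-- The normalized transfer operator of the matrices `A i` on functions on `Fin k × ι`. -/
noncomputable def transfer (A : Fin k → Matrix ι ι ℕ) (ρ : Fin k → ℝ) :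
    Module.End ℝ (Fin k × ι → ℝ) where
  toFun Y a := (ρ a.1)⁻¹ * ∑ q, (A a.1 a.2 q : ℝ) * Y (a.1 + 1, q)
  map_add' Y Z := by
    funext a
    simp only [Pi.add_apply, mul_add, Finset.sum_add_distrib]
  map_smul' c Y := by
    funext a
    simp only [Pi.smul_apply, smul_eq_mul, RingHom.id_apply, Finset.mul_sum]
    exact Finset.sum_congr rfl fun q _ => by ring

variable {A : Fin k → Matrix ι ι ℕ} {ρ : Fin k → ℝ} {x : ι → ℝ}

theorem transfer_apply (Y : Fin k × ι → ℝ) (a : Fin k × ι) :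
    transfer A ρ Y a = (ρ a.1)⁻¹ * ∑ q, (A a.1 a.2 q : ℝ) * Y (a.1 + 1, q) := rfl

theorem transfer_nonneg (hρ : ∀ i, 0 < ρ i) (Y : Fin k × ι → ℝ) (hY : 0 ≤ Y) :
    0 ≤ transfer A ρ Y := fun _ =>
  mul_nonneg (inv_nonneg.2 (hρ _).le)
    (Finset.sum_nonneg fun _ _ => mul_nonneg (Nat.cast_nonneg _) (hY _))

theorem transfer_pow_nonneg (hρ : ∀ i, 0 < ρ i) (Y : Fin k × ι → ℝ) (hY : 0 ≤ Y) (j : ℕ) :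
    0 ≤ (transfer A ρ ^ j) Y := by
  induction j with
  | zero => exact hY
  | succ j ih =>
    rw [pow_succ', Module.End.mul_apply]
    exact transfer_nonneg hρ _ ih

theorem transfer_eigenvector (hρ : ∀ i, 0 < ρ i) (hA : ∀ i p, ∑ q, (A i p q : ℝ) * x q = ρ i * x p) :
    transfer A ρ (fun a => x a.2) = fun a => x a.2 := by
  funext a
  rw [transfer_apply, hA, ← mul_assoc, inv_mul_cancel₀ (hρ _).ne', one_mul]

theorem ofNat_succ (n : ℕ) : Fin.ofNat k (n + 1) = Fin.ofNat k n + 1 := by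
  apply Fin.ext
  rw [Fin.val_add]
  simp [Fin.ofNat]

/-- Summing out the last edge applies the current adjacency matrix and removes one factor from
`levelProd`. The `Fin k` coordinate records which matrix is current, so all steps are powers of one
operator. -/
theorem levelSum_stationary_add (hρ : ∀ i, 0 < ρ i) {Q : (stationary A).FinitePath → Prop} {m : ℕ}
    (hQ : ∀ n, m ≤ n → ∀ (p q : ι) (μ : (stationary A).PathTo n p) (e : (stationary A).E n p q),
      Q ⟨n + 1, q, μ.snoc e⟩ ↔ Q ⟨n, p, μ⟩)
    (j : ℕ) (Y : Fin k × ι → ℝ) (hY : 0 ≤ Y) :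
    levelSum Q (m + j) (fun q : ι =>
        ENNReal.ofReal ((levelProd ρ (m + j))⁻¹ * Y (Fin.ofNat k (m + j), q))) =
      levelSum Q m (fun q : ι =>
        ENNReal.ofReal ((levelProd ρ m)⁻¹ * (transfer A ρ ^ j) Y (Fin.ofNat k m, q))) := by
  induction j generalizing Y with
  | zero => rfl
  | succ j ih =>
    rw [pow_succ, Module.End.mul_apply, ← ih _ (transfer_nonneg hρ Y hY), ← add_assoc,
      levelSum_succ (hQ (m + j) (Nat.le_add_right m j))]
    congr 1
    funext p
    rw [transfer_apply, tsum_fintype, ← mul_assoc, ← mul_inv, ← levelProd_succ, Finset.mul_sum,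
      ENNReal.ofReal_sum_of_nonneg]
    · refine Finset.sum_congr rfl fun q _ => ?_
      change (∑' _ : Fin (A (Fin.ofNat k (m + j)) p q), _) = _
      rw [tsum_fintype, Finset.sum_const, Finset.card_univ, Fintype.card_fin, nsmul_eq_mul,
        ← ENNReal.ofReal_natCast, ← ENNReal.ofReal_mul (Nat.cast_nonneg _), ofNat_succ]
      congr 1
      ring
    · exact fun q _ => mul_nonneg (inv_nonneg.2 (levelProd_pos hρ _).le)
        (mul_nonneg (Nat.cast_nonneg _) (hY _))

/-- The weight of a path, as a function of its length and its source. -/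
noncomputable def sourceWeight (ρ : Fin k → ℝ) (x : ι → ℝ) (δ : ℝ)
    (η : (stationary A).FinitePath) : ℝ :=
  levelProd ρ η.1 ^ (-(1 / δ)) * x η.2.1

/-- The factor of `sourceWeight ^ s` that is not geometric in the length of the path. -/
noncomputable def boundedFactor (ρ : Fin k → ℝ) (x : ι → ℝ) (δ s : ℝ) (a : Fin k × ι) : ℝ :=
  periodicFactor ρ a.1.val ^ (1 - s / δ) * x a.2 ^ s

/-- The ratio of the geometric part of `sourceWeight ^ s`. -/
noncomputable def decayRate (ρ : Fin k → ℝ) (δ s : ℝ) : ℝ := growthRate ρ ^ (1 - s / δ)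

variable {δ : ℝ}

theorem sourceWeight_pos (hρ : ∀ i, 0 < ρ i) (hx : ∀ p, 0 < x p) (η : (stationary A).FinitePath) :
    0 < sourceWeight ρ x δ η :=
  mul_pos (Real.rpow_pos_of_pos (levelProd_pos hρ _) _) (hx _)

omit [NeZero k] [Fintype ι] in
theorem boundedFactor_pos (hρ : ∀ i, 0 < ρ i) (hx : ∀ p, 0 < x p) (s : ℝ) (a : Fin k × ι) :
    0 < boundedFactor ρ x δ s a :=
  mul_pos (Real.rpow_pos_of_pos (periodicFactor_pos hρ _) _) (Real.rpow_pos_of_pos (hx _) _)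

omit [NeZero k] in
theorem decayRate_pos (hρ : ∀ i, 0 < ρ i) (s : ℝ) : 0 < decayRate ρ δ s :=
  Real.rpow_pos_of_pos (growthRate_pos hρ) _

/-- Splits `L ^ (-s/δ)` as `L⁻¹ * L ^ (1 - s/δ)` and then the second factor into its geometric and
periodic parts. -/
theorem sourceWeight_rpow (hρ : ∀ i, 0 < ρ i) (hx : ∀ p, 0 < x p) (s : ℝ)
    (η : (stationary A).FinitePath) :
    sourceWeight ρ x δ η ^ s = (levelProd ρ η.1)⁻¹ *
      (decayRate ρ δ s ^ η.1 * boundedFactor ρ x δ s (Fin.ofNat k η.1, η.2.1)) := by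
  have h1 := levelProd_pos hρ η.1
  have h2 := growthRate_pos hρ
  rw [sourceWeight, Real.mul_rpow (Real.rpow_pos_of_pos h1 _).le (hx _).le, ← Real.rpow_mul h1.le,
    boundedFactor, periodicFactor_ofNat hρ, decayRate, ← Real.rpow_mul_natCast h2.le,
    mul_comm (1 - s / δ), Real.rpow_natCast_mul h2.le, ← mul_assoc (_ ^ (1 - s / δ)),
    ← Real.mul_rpow (pow_pos h2 _).le (periodicFactor_pos hρ _).le, ← levelProd_eq hρ,
    Real.rpow_sub h1, Real.rpow_one, ← mul_assoc, ← mul_div_assoc, inv_mul_cancel₀ h1.ne',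
    one_div (levelProd ρ η.1 ^ _), ← Real.rpow_neg h1.le]
  congr 2
  ring

/-- The sum of `sourceWeight ^ s` over the paths that satisfy `Q`, in terms of the transfer
operator. -/
theorem levelSum_sourceWeight (hρ : ∀ i, 0 < ρ i) (hx : ∀ p, 0 < x p)
    {Q : (stationary A).FinitePath → Prop} {m : ℕ}
    (hQ : ∀ n, m ≤ n → ∀ (p q : ι) (μ : (stationary A).PathTo n p) (e : (stationary A).E n p q),
      Q ⟨n + 1, q, μ.snoc e⟩ ↔ Q ⟨n, p, μ⟩) (s : ℝ) (j : ℕ) :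
    levelSum Q (m + j) (fun q : ι => ENNReal.ofReal ((levelProd ρ (m + j))⁻¹ *
        (decayRate ρ δ s ^ (m + j) * boundedFactor ρ x δ s (Fin.ofNat k (m + j), q)))) =
      levelSum Q m (fun q : ι => ENNReal.ofReal ((levelProd ρ m)⁻¹ * (decayRate ρ δ s ^ (m + j) *
        (transfer A ρ ^ j) (boundedFactor ρ x δ s) (Fin.ofNat k m, q)))) := by
  have h := levelSum_stationary_add hρ hQ j (decayRate ρ δ s ^ (m + j) • boundedFactor ρ x δ s)
    fun a => mul_nonneg (pow_nonneg (decayRate_pos hρ s).le _) (boundedFactor_pos hρ hx s a).le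
  rw [map_smul] at h
  exact h

theorem extensionSum_sourceWeight (hρ : ∀ i, 0 < ρ i) (hx : ∀ p, 0 < x p) (s : ℝ)
    (γ : (stationary A).FinitePath) :
    (stationary A).extensionSum (sourceWeight ρ x δ) γ s =
      ∑' j : ℕ, ENNReal.ofReal ((levelProd ρ γ.1)⁻¹ * (decayRate ρ δ s ^ (γ.1 + j) *
        (transfer A ρ ^ j) (boundedFactor ρ x δ s) (Fin.ofNat k γ.1, γ.2.1))) := by
  classical
  have h1 : (stationary A).extensionSum (sourceWeight ρ x δ) γ s =
      ∑' μ : (stationary A).FinitePath, if (stationary A).IsSubPath γ μ then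
        ENNReal.ofReal ((levelProd ρ μ.1)⁻¹ *
          (decayRate ρ δ s ^ μ.1 * boundedFactor ρ x δ s (Fin.ofNat k μ.1, μ.2.1))) else 0 := by
    refine (tsum_subtype {μ | (stationary A).IsSubPath γ μ}
      fun μ => ENNReal.ofReal (sourceWeight ρ x δ μ ^ s)).trans (tsum_congr fun μ => ?_)
    simp only [Set.indicator, sourceWeight_rpow hρ hx]
    rfl
  rw [h1, tsum_ite_eq_tsum_levelSum (B := stationary A) (fun n (q : ι) =>
      ENNReal.ofReal ((levelProd ρ n)⁻¹ *
        (decayRate ρ δ s ^ n * boundedFactor ρ x δ s (Fin.ofNat k n, q)))),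
    ← ENNReal.summable.sum_add_tsum_nat_add' (k := γ.1)]
  rw [Finset.sum_eq_zero fun n hn => levelSum_isSubPath_of_lt (Finset.mem_range.1 hn) _, zero_add]
  refine tsum_congr fun j => ?_
  rw [add_comm j, levelSum_sourceWeight hρ hx (fun n hn p q μ e => IsSubPath.snoc_iff hn) s j,
    levelSum_isSubPath_self]

theorem pathSum_sourceWeight (hρ : ∀ i, 0 < ρ i) (hx : ∀ p, 0 < x p) (s : ℝ) :
    (stationary A).pathSum (sourceWeight ρ x δ) s =
      ∑' j : ℕ, ∑ p : ι, ENNReal.ofReal (decayRate ρ δ s ^ j *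
        (transfer A ρ ^ j) (boundedFactor ρ x δ s) (0, p)) := by
  classical
  have h1 : (stationary A).pathSum (sourceWeight ρ x δ) s =
      ∑' μ : (stationary A).FinitePath, if True then
        ENNReal.ofReal ((levelProd ρ μ.1)⁻¹ *
          (decayRate ρ δ s ^ μ.1 * boundedFactor ρ x δ s (Fin.ofNat k μ.1, μ.2.1))) else 0 :=
    tsum_congr fun μ => by rw [sourceWeight_rpow hρ hx, if_pos trivial]
  let φ (n : ℕ) (q : ι) : ℝ≥0∞ := ENNReal.ofReal ((levelProd ρ n)⁻¹ *
    (decayRate ρ δ s ^ n * boundedFactor ρ x δ s (Fin.ofNat k n, q)))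
  rw [h1, tsum_ite_eq_tsum_levelSum (B := stationary A) φ]
  refine tsum_congr fun j => ?_
  refine (congrArg (fun n => levelSum (B := stationary A) (fun _ => True) n (φ n))
    (zero_add j).symm).trans ((levelSum_sourceWeight hρ hx
      (fun _ _ _ _ _ _ => Iff.rfl) s j).trans ?_)
  rw [levelSum_true_zero]
  refine (tsum_fintype _).trans (Finset.sum_congr rfl fun p _ => ?_)
  rw [levelProd_zero, inv_one, one_mul, zero_add]
  rfl

/-- The Abel sum of the transfer operator that governs `extensionSum`. -/
noncomputable def transferSum (A : Fin k → Matrix ι ι ℕ) (ρ : Fin k → ℝ) (x : ι → ℝ) (δ s : ℝ)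
    (a : Fin k × ι) : ℝ :=
  ∑' j : ℕ, decayRate ρ δ s ^ j * (transfer A ρ ^ j) (boundedFactor ρ x δ s) a

variable (hρ : ∀ i, 0 < ρ i) (hx : ∀ p, 0 < x p)
  (hA : ∀ i p, ∑ q, (A i p q : ℝ) * x q = ρ i * x p)
include hρ hx

theorem le_boundedFactor [Nonempty ι] (s : ℝ) :
    ∃ c, 0 < c ∧ ∀ a : Fin k × ι, c * x a.2 ≤ boundedFactor ρ x δ s a := by
  obtain ⟨a, ha⟩ := Finite.exists_min fun a : Fin k × ι => boundedFactor ρ x δ s a / x a.2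
  exact ⟨_, div_pos (boundedFactor_pos hρ hx s a) (hx _), fun b => (le_div_iff₀ (hx _)).1 (ha b)⟩

theorem transferSum_nonneg (s : ℝ) (a : Fin k × ι) : 0 ≤ transferSum A ρ x δ s a :=
  tsum_nonneg fun j => mul_nonneg (pow_nonneg (decayRate_pos hρ s).le _)
    (transfer_pow_nonneg hρ _ (fun a => (boundedFactor_pos hρ hx s a).le) j a)

include hA

/-- By positivity `T ^ j` keeps the lower bound by a multiple of `x`, so for ratio at least one the
terms do not tend to zero. -/
theorem pathSum_eq_top [Nonempty ι] {s : ℝ} (hr : 1 ≤ decayRate ρ δ s) :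
    (stationary A).pathSum (sourceWeight ρ x δ) s = ∞ := by
  obtain ⟨c, hc, hle⟩ := le_boundedFactor (δ := δ) hρ hx s
  obtain ⟨p⟩ := ‹Nonempty ι›
  rw [pathSum_sourceWeight hρ hx, eq_top_iff, ← ENNReal.tsum_const_eq_top_of_ne_zero (α := ℕ)
    (c := ENNReal.ofReal (c * x p)) (by simpa using mul_pos hc (hx p))]
  refine ENNReal.tsum_le_tsum fun j => le_trans (ENNReal.ofReal_le_ofReal ?_)
    (Finset.single_le_sum (f := fun p : ι => ENNReal.ofReal (decayRate ρ δ s ^ j *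
        (transfer A ρ ^ j) (boundedFactor ρ x δ s) (0, p))) (fun _ _ => zero_le) (Finset.mem_univ p))
  have h1 := le_pow_apply (transfer_nonneg hρ) (transfer_eigenvector hρ hA) hle j (0, p)
  exact h1.trans (le_mul_of_one_le_left ((mul_pos hc (hx p)).le.trans h1) (one_le_pow₀ hr))

theorem transferSum_summable {s : ℝ} (hr : decayRate ρ δ s < 1) (a : Fin k × ι) :
    Summable fun j : ℕ => decayRate ρ δ s ^ j * (transfer A ρ ^ j) (boundedFactor ρ x δ s) a :=
  summable_abel (transfer_nonneg hρ) (transfer_eigenvector hρ hA) (fun _ => hx _) _ a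
    (decayRate_pos hρ s).le hr

theorem extensionSum_eq_ofReal {s : ℝ} (hr : decayRate ρ δ s < 1) (γ : (stationary A).FinitePath) :
    (stationary A).extensionSum (sourceWeight ρ x δ) γ s =
      ENNReal.ofReal ((levelProd ρ γ.1)⁻¹ * (decayRate ρ δ s ^ γ.1 *
        transferSum A ρ x δ s (Fin.ofNat k γ.1, γ.2.1))) := by
  have hs := transferSum_summable (δ := δ) hρ hx hA hr (Fin.ofNat k γ.1, γ.2.1)
  rw [extensionSum_sourceWeight hρ hx, transferSum, ← tsum_mul_left, ← tsum_mul_left,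
    ENNReal.ofReal_tsum_of_nonneg]
  · refine tsum_congr fun j => ?_
    rw [pow_add, mul_assoc]
  · exact fun j => mul_nonneg (inv_nonneg.2 (levelProd_pos hρ _).le)
      (mul_nonneg (pow_nonneg (decayRate_pos hρ s).le _)
        (mul_nonneg (pow_nonneg (decayRate_pos hρ s).le _)
        (transfer_pow_nonneg hρ _ (fun a => (boundedFactor_pos hρ hx s a).le) j _)))
  · exact (hs.mul_left _).mul_left _

theorem pathSum_eq_ofReal {s : ℝ} (hr : decayRate ρ δ s < 1) :
    (stationary A).pathSum (sourceWeight ρ x δ) s =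
      ENNReal.ofReal (∑ p, transferSum A ρ x δ s (0, p)) := by
  rw [pathSum_sourceWeight hρ hx, Summable.tsum_finsetSum fun _ _ => ENNReal.summable,
    ENNReal.ofReal_sum_of_nonneg fun p _ => transferSum_nonneg hρ hx s _]
  refine Finset.sum_congr rfl fun p _ => ?_
  rw [transferSum, ENNReal.ofReal_tsum_of_nonneg]
  · exact fun j => mul_nonneg (pow_nonneg (decayRate_pos hρ s).le _)
        (transfer_pow_nonneg hρ _ (fun a => (boundedFactor_pos hρ hx s a).le) j _)
  · exact transferSum_summable hρ hx hA hr _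

end Transfer

end BratteliDiagram

/-! ### Traces in the spectral triple. -/

namespace BratteliDiagram

section SpectralTriple

variable {B : BratteliDiagram.{u, v}} {w : B.FinitePath → ℝ}

/-- An empty or one-point cylinder has diameter zero, the empty case by the convention for `sSup ∅`.
This turns the diameter hypothesis into branching of paths. -/
theorem exists_ne_of_diam_pos {γ : B.FinitePath} (h : 0 < B.diam w γ) :
    ∃ x ∈ B.cylinder γ, ∃ y ∈ B.cylinder γ, x ≠ y := by
  by_contra! hcon
  refine h.not_ge (Real.sSup_nonpos ?_)
  rintro r ⟨x, hx, y, hy, rfl⟩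
  simp [pathDist, hcon x hx y hy]

/-- The square of the block is `t ^ 2`, so its spectrum lies in `{t, -t}`, where `g` is constant. -/
theorem cfc_smul_offDiagonal {t : ℝ} {g : ℝ → ℝ} (hg : ∀ a, a ^ 2 = t ^ 2 → g a = g t) :
    cfc g (((t : ℝ) : ℂ) • !![0, 1; 1, 0] : Matrix (Fin 2) (Fin 2) ℂ) =
      ((g t : ℝ) : ℂ) • (1 : Matrix (Fin 2) (Fin 2) ℂ) := by
  set D : Matrix (Fin 2) (Fin 2) ℂ := ((t : ℝ) : ℂ) • !![0, 1; 1, 0] with hD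
  have hsa : IsSelfAdjoint D := by
    rw [IsSelfAdjoint, Matrix.star_eq_conjTranspose]
    ext i j
    fin_cases i <;> fin_cases j <;> simp [hD, Matrix.conjTranspose]
  have hsq : D * D = algebraMap ℝ (Matrix (Fin 2) (Fin 2) ℂ) (t ^ 2) := by
    rw [Algebra.algebraMap_eq_smul_one]
    ext i j
    fin_cases i <;> fin_cases j <;> simp [hD, Matrix.mul_apply, Fin.sum_univ_two, pow_two]
  have hspec : ∀ a ∈ spectrum ℝ D, a ^ 2 = t ^ 2 := by
    intro a ha
    by_contra hne
    refine ha ?_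
    have hc : Commute (algebraMap ℝ (Matrix (Fin 2) (Fin 2) ℂ) a) D := Algebra.commutes a D
    have h1 : (algebraMap ℝ (Matrix (Fin 2) (Fin 2) ℂ) a - D) *
        (algebraMap ℝ (Matrix (Fin 2) (Fin 2) ℂ) a + D) =
        algebraMap ℝ (Matrix (Fin 2) (Fin 2) ℂ) (a ^ 2 - t ^ 2) := by
      rw [← hc.mul_self_sub_mul_self_eq', hsq, map_sub,
        ← map_mul, pow_two a]
    have h2 : IsUnit (algebraMap ℝ (Matrix (Fin 2) (Fin 2) ℂ) (a ^ 2 - t ^ 2)) :=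
      (IsUnit.mk0 _ (sub_ne_zero.2 hne)).map _
    rw [← h1] at h2
    have hcomm : Commute (algebraMap ℝ (Matrix (Fin 2) (Fin 2) ℂ) a - D)
        (algebraMap ℝ (Matrix (Fin 2) (Fin 2) ℂ) a + D) :=
      ((Commute.refl _).add_right hc).sub_left (hc.symm.add_right (Commute.refl _))
    exact (hcomm.isUnit_mul_iff.1 h2).1
  rw [cfc_congr (g := fun _ => g t) fun a ha => hg a (hspec a ha), cfc_const _ _ hsa,
    Algebra.algebraMap_eq_smul_one]
  ext i j
  simp

theorem absDiracPow_eq {γ : B.FinitePath} (h : 0 < B.diam w γ) (s : ℝ) :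
    B.absDiracPow w s γ =
      ((B.diam w γ ^ s : ℝ) : ℂ) • (1 : Matrix (Fin 2) (Fin 2) ℂ) := by
  rw [absDiracPow, dirac, cfc_smul_offDiagonal]
  · congr 2
    rw [abs_of_pos (one_div_pos.2 h), one_div, Real.inv_rpow h.le, Real.rpow_neg h.le, inv_inv]
  · intro a ha
    rw [(sq_eq_sq_iff_abs_eq_abs _ _).1 ha]

variable (hw : ∀ γ, 0 < w γ) (hdiam : ∀ γ, w γ = B.diam w γ)
include hw hdiam

theorem trace_absDiracPow (s : ℝ) (γ : B.FinitePath) :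
    (B.absDiracPow w s γ).trace = ((2 * w γ ^ s : ℝ) : ℂ) := by
  rw [absDiracPow_eq (hdiam γ ▸ hw γ), ← hdiam]
  simp [Matrix.trace_smul, mul_comm]

theorem trace_absDiracPow_mul_rep (τ : B.ChoiceFunction w) (f : B.InfinitePath → ℂ) (s : ℝ)
    (γ : B.FinitePath) : ((B.absDiracPow w s * B.rep τ f) γ).trace =
      ((w γ ^ s : ℝ) : ℂ) * f (τ.pos γ) + ((w γ ^ s : ℝ) : ℂ) * f (τ.neg γ) := by
  rw [Pi.mul_apply, absDiracPow_eq (hdiam γ ▸ hw γ), ← hdiam]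
  simp [rep, Matrix.trace_fin_two]

theorem zeta_eq_pathSum (s : ℝ) : B.zeta w s = B.pathSum w s := by
  rw [zeta, positiveTrace, pathSum, ← ENNReal.tsum_mul_left]
  refine tsum_congr fun γ => ?_
  rw [trace_absDiracPow hw hdiam, Complex.ofReal_re, ENNReal.ofReal_mul zero_le_two,
    ENNReal.ofReal_ofNat, ← mul_assoc, ENNReal.inv_mul_cancel two_ne_zero ENNReal.ofNat_ne_top,
    one_mul]

/-- The quotient of traces is the mean of the integrals of `f` against the point measures at `τ.pos`
and `τ.neg`, which have the same limit. -/
theorem hasDixmierTrace_of_tendsto {δ : ℝ} (hpos : ∀ s, B.pathSum w s ≠ 0)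
    (hfin : ∀ s, δ < s → B.pathSum w s ≠ ∞) {P : Measure B.InfinitePath}
    (hP : ∀ z : B.FinitePath → B.InfinitePath, (∀ γ, z γ ∈ B.cylinder γ) →
        ∀ f : B.InfinitePath → ℂ, Continuous f →
          Tendsto (fun s => ∫ x, f x ∂(pointMeasure w z s)) (𝓝[>] δ) (𝓝 (∫ x, f x ∂P)))
    (τ : B.ChoiceFunction w) {f : B.InfinitePath → ℂ} (hf : Continuous f) :
    B.HasDixmierTrace τ δ f (∫ x, f x ∂P) := by
  have hrep : ∀ s, (fun γ => ((B.absDiracPow w s * B.rep τ f) γ).trace) = fun γ =>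
      ((w γ ^ s : ℝ) : ℂ) * f (τ.pos γ) + ((w γ ^ s : ℝ) : ℂ) * f (τ.neg γ) := fun s =>
    funext (trace_absDiracPow_mul_rep hw hdiam τ f s)
  have habs : ∀ s, (fun γ => (B.absDiracPow w s γ).trace) = fun γ => ((2 * w γ ^ s : ℝ) : ℂ) :=
    fun s => funext (trace_absDiracPow hw hdiam s)
  refine ⟨fun s hs => ⟨?_, ?_⟩, ?_⟩
  · rw [TraceSummable, habs, Complex.summable_ofReal]
    exact (summable_of_pathSum_ne_top hw (hfin s hs)).mul_left 2
  · rw [TraceSummable, hrep]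
    exact (summable_rpow_mul hw (hfin s hs) hf).add (summable_rpow_mul hw (hfin s hs) hf)
  · have h := ((hP τ.pos τ.pos_mem f hf).add (hP τ.neg τ.neg_mem f hf)).div_const 2
    rw [add_self_div_two] at h
    refine h.congr' ?_
    filter_upwards [self_mem_nhdsWithin] with s hs
    have hs' := hfin s hs
    rw [integral_pointMeasure hw (hpos s) hs' hf, integral_pointMeasure hw (hpos s) hs' hf,
      blockTrace, blockTrace, hrep, habs,
      (summable_rpow_mul hw hs' hf).tsum_add (summable_rpow_mul hw hs' hf),
      ← Complex.ofReal_tsum, tsum_mul_left, ← add_div, div_div]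
    congr 1
    push_cast
    ring

end SpectralTriple

/-- Lipschitz functions are continuous if the weight tends to zero. -/
theorem IsLipschitz.continuous {B : BratteliDiagram.{u, v}} {w : B.FinitePath → ℝ}
    {f : B.InfinitePath → ℂ} (hf : B.IsLipschitz w f) (hw : ∀ γ, 0 < w γ) {s : ℝ} (hs : 0 < s)
    (hsum : Summable fun γ => w γ ^ s) : Continuous f := by
  obtain ⟨C, hC⟩ := hf
  rw [continuous_iff_continuousAt]
  intro x
  rw [ContinuousAt, Metric.tendsto_nhds]
  intro ε hε
  set ε' := ε / (|C| + 1) with hε'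
  have hC0 : 0 < |C| + 1 := by positivity
  have hε'0 : 0 < ε' := div_pos hε hC0
  -- Summability leaves only finitely many paths of weight at least `ε'`, so their lengths are
  -- bounded.
  have hfin : {γ | ¬ w γ ^ s < ε' ^ s}.Finite :=
    hsum.tendsto_cofinite_zero.eventually_lt_const (Real.rpow_pos_of_pos hε'0 s)
  obtain ⟨N, hN⟩ := (hfin.image Sigma.fst).bddAbove
  have hsmall : ∀ γ : B.FinitePath, N < γ.1 → w γ < ε' := by
    intro γ hγ
    by_contra hcon
    refine hγ.not_ge (hN ⟨γ, fun h => hcon ?_, rfl⟩)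
    exact (Real.rpow_lt_rpow_iff (hw γ).le hε'0.le hs).1 h
  have hmem : B.cylinder (x.take (N + 1)) ∈ 𝓝 x :=
    (InfinitePath.isOpen_cylinder _).mem_nhds rfl
  filter_upwards [hmem] with y hy
  have hyx : y.take (N + 1) = x.take (N + 1) := hy
  have hdist : 0 ≤ B.pathDist w y x ∧ B.pathDist w y x < ε' := by
    rw [pathDist]
    split_ifs with h1 h2
    · exact ⟨le_rfl, hε'0⟩
    · exact absurd (congrArg Sigma.fst (InfinitePath.take_eq_take_iff.1
        (InfinitePath.take_eq_take_of_le (Nat.zero_le _) hyx))) h2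
    · refine ⟨(hw _).le, hsmall _ ?_⟩
      -- Distinct paths differ at some length, so the supremum defining the meet is a genuine one.
      have hbdd : BddAbove {n | y.take n = x.take n} := by
        obtain ⟨m, hm⟩ : ∃ m, y.take m ≠ x.take m := by
          by_contra! h
          exact h1 (InfinitePath.ext_take h)
        refine ⟨m, fun n hn => ?_⟩
        by_contra! h
        exact hm (InfinitePath.take_eq_take_of_le h.le hn)
      exact Nat.lt_of_succ_le (le_csSup hbdd hyx)
  rw [dist_eq_norm]
  calc ‖f y - f x‖ ≤ C * B.pathDist w y x := hC y x
    _ ≤ (|C| + 1) * B.pathDist w y x :=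
      mul_le_mul_of_nonneg_right ((le_abs_self C).trans (by linarith)) hdist.1
    _ < (|C| + 1) * ε' := mul_lt_mul_of_pos_left hdist.2 hC0
    _ = ε := by rw [hε', mul_div_cancel₀ _ hC0.ne']

end BratteliDiagram

/-! ### Branching forces exponential growth. -/

namespace BratteliDiagram

section Growth

variable {k : ℕ} [NeZero k] {ι : Type u} [Fintype ι] {A : Fin k → Matrix ι ι ℕ} {ρ : Fin k → ℝ}
  {x : ι → ℝ}

/-- The normalized mass at level `n` of a path with source `p`. -/
noncomputable def levelMass (ρ : Fin k → ℝ) (x : ι → ℝ) (n : ℕ) (p : ι) : ℝ :=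
  (levelProd ρ n)⁻¹ * x p

/-- The eigenvector equation distributes the mass of a path over its one-edge extensions. -/
theorem sum_levelMass (hρ : ∀ i, 0 < ρ i) (hA : ∀ i p, ∑ q, (A i p q : ℝ) * x q = ρ i * x p)
    (n : ℕ) (p : ι) :
    ∑ e : (Σ q, Fin (A (Fin.ofNat k n) p q)), levelMass ρ x (n + 1) e.1 = levelMass ρ x n p := by
  have h1 := (hρ (Fin.ofNat k n)).ne'
  have h2 := (levelProd_pos hρ n).ne'
  simp only [levelMass]
  rw [← Finset.mul_sum, Fintype.sum_sigma]
  simp only [Finset.sum_const, Finset.card_univ, Fintype.card_fin, nsmul_eq_mul, hA,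
    levelProd_succ]
  field_simp

omit [NeZero k] [Fintype ι] in
theorem levelMass_pos (hρ : ∀ i, 0 < ρ i) (hx : ∀ p, 0 < x p) (n : ℕ) (p : ι) :
    0 < levelMass ρ x n p :=
  mul_pos (inv_pos.2 (levelProd_pos hρ n)) (hx p)

variable (hρ : ∀ i, 0 < ρ i) (hx : ∀ p, 0 < x p)
  (hA : ∀ i p, ∑ q, (A i p q : ℝ) * x q = ρ i * x p)
include hρ hx hA

theorem levelMass_antitone (y : (stationary A).InfinitePath) :
    Antitone fun n => levelMass ρ x n (y.vertex n) := by
  refine antitone_nat_of_succ_le fun n => ?_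
  rw [← sum_levelMass hρ hA n]
  exact Finset.single_le_sum
    (f := fun e : (Σ q, Fin (A (Fin.ofNat k n) (y.vertex n) q)) => levelMass ρ x (n + 1) e.1)
    (fun _ _ => (levelMass_pos hρ hx _ _).le)
    (Finset.mem_univ (⟨y.vertex (n + 1), y.edge n⟩ :
      (Σ q, Fin (A (Fin.ofNat k n) (y.vertex n) q))))

theorem levelMass_add_le {n : ℕ} {y y' : (stationary A).InfinitePath}
    (h : y.take n = y'.take n) (h' : y.take (n + 1) ≠ y'.take (n + 1)) :
    levelMass ρ x (n + 1) (y.vertex (n + 1)) + levelMass ρ x (n + 1) (y'.vertex (n + 1)) ≤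
      levelMass ρ x n (y.vertex n) := by
  classical
  -- Stated for two equal levels so that both edges can be brought to a common starting vertex by
  -- substitution.
  have key : ∀ a b : (stationary A).Level n, a = b →
      ∀ (e : Σ q, Fin (A (Fin.ofNat k n) a.1 q)) (e' : Σ q, Fin (A (Fin.ofNat k n) b.1 q)),
      (⟨e.1, a.2.snoc e.2⟩ : (stationary A).Level (n + 1)) ≠ ⟨e'.1, b.2.snoc e'.2⟩ →
      levelMass ρ x (n + 1) e.1 + levelMass ρ x (n + 1) e'.1 ≤ levelMass ρ x n a.1 := by
    rintro a _ rfl e e' hne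
    have hee : e ≠ e' := by
      rintro rfl
      exact hne rfl
    rw [← sum_levelMass hρ hA n,
      ← Finset.sum_pair (f := fun e : (Σ q, Fin (A (Fin.ofNat k n) a.1 q)) =>
        levelMass ρ x (n + 1) e.1) hee]
    exact Finset.sum_le_sum_of_subset_of_nonneg (Finset.subset_univ _)
      fun _ _ _ => (levelMass_pos hρ hx _ _).le
  exact key (y.level n) (y'.level n) (InfinitePath.take_eq_take_iff.1 h)
    ⟨y.vertex (n + 1), y.edge n⟩ ⟨y'.vertex (n + 1), y'.edge n⟩
    fun h3 => h' (InfinitePath.take_eq_take_iff.2 h3)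

/-- If the growth rate were at most one, `levelProd` would be bounded by its periodic factor and all
level masses would exceed some `c > 0`. Every path has an extension at which two paths separate, and
the sibling takes mass at least `c`. Repeating this exhausts the mass of the starting vertex. -/
theorem one_lt_growthRate [Nonempty ι]
    (h2 : ∀ γ : (stationary A).FinitePath, ∃ y ∈ (stationary A).cylinder γ,
      ∃ y' ∈ (stationary A).cylinder γ, y ≠ y') : 1 < growthRate ρ := by
  by_contra! hle
  obtain ⟨c, hc, hmass⟩ : ∃ c, 0 < c ∧ ∀ n p, c ≤ levelMass ρ x n p := by
    obtain ⟨a, ha⟩ := Finite.exists_min fun a : Fin k × ι => x a.2 / periodicFactor ρ a.1.val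
    refine ⟨_, div_pos (hx a.2) (periodicFactor_pos hρ a.1.val), fun n p => ?_⟩
    refine (ha (Fin.ofNat k n, p)).trans ?_
    rw [periodicFactor_ofNat hρ, levelMass, ← div_eq_inv_mul]
    refine div_le_div_of_nonneg_left (hx p).le (levelProd_pos hρ n) ?_
    rw [levelProd_eq hρ]
    exact mul_le_of_le_one_left (periodicFactor_pos hρ n).le
      (pow_le_one₀ (growthRate_pos hρ).le hle)
  have hstep : ∀ γ : (stationary A).FinitePath, ∃ γ' : (stationary A).FinitePath,
      levelMass ρ x γ'.1 γ'.2.1 + c ≤ levelMass ρ x γ.1 γ.2.1 := by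
    intro γ
    obtain ⟨y, hy, y', hy', hne⟩ := h2 γ
    have hex : ∃ n, y.take n ≠ y'.take n := by
      by_contra! h
      exact hne (InfinitePath.ext_take h)
    have hγ : y.take γ.1 = y'.take γ.1 := Eq.trans hy (Eq.symm hy')
    classical
    obtain ⟨n, hn, hmin⟩ : ∃ n, y.take n ≠ y'.take n ∧ ∀ m < n, y.take m = y'.take m :=
      ⟨Nat.find hex, Nat.find_spec hex, fun m hm => not_not.1 (Nat.find_min hex hm)⟩
    have hlt : γ.1 < n := by
      by_contra! h
      exact hn (InfinitePath.take_eq_take_of_le h hγ)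
    obtain ⟨m, rfl⟩ := Nat.exists_eq_succ_of_ne_zero (Nat.ne_zero_of_lt hlt)
    refine ⟨y.take (m + 1), ?_⟩
    have h3 := levelMass_add_le hρ hx hA (hmin m (Nat.lt_succ_self m)) hn
    have h4 : levelMass ρ x m (y.vertex m) ≤ levelMass ρ x γ.1 (y.vertex γ.1) :=
      levelMass_antitone hρ hx hA y (Nat.lt_succ_iff.1 hlt)
    have h5 : levelMass ρ x γ.1 (y.vertex γ.1) = levelMass ρ x γ.1 γ.2.1 :=
      congrArg (fun η : (stationary A).FinitePath => levelMass ρ x η.1 η.2.1)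
        (show y.take γ.1 = γ from hy)
    exact (add_le_add le_rfl (hmass _ (y'.vertex (m + 1)))).trans (h3.trans (h4.trans h5.le))
  obtain ⟨p⟩ := ‹Nonempty ι›
  let γ₀ : (stationary A).FinitePath := ⟨0, p, .vertex (B := stationary A) p⟩
  have hiter : ∀ N : ℕ, ∃ γ : (stationary A).FinitePath,
      levelMass ρ x γ.1 γ.2.1 + N * c ≤ levelMass ρ x 0 p := by
    intro N
    induction N with
    | zero => exact ⟨γ₀, by simp [γ₀]⟩
    | succ N ih =>
      obtain ⟨γ, hγ⟩ := ih
      obtain ⟨γ', hγ'⟩ := hstep γ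
      refine ⟨γ', ?_⟩
      push_cast
      linarith
  obtain ⟨N, hN⟩ := exists_nat_gt (levelMass ρ x 0 p / c)
  obtain ⟨γ, hγ⟩ := hiter N
  rw [div_lt_iff₀ hc] at hN
  have := levelMass_pos hρ hx γ.1 γ.2.1
  linarith

end Growth

/-! ### The abscissa and the limits at `δ`. -/

section Limits

variable {k : ℕ} [NeZero k] {ι : Type u} [Fintype ι] [Nonempty ι] {A : Fin k → Matrix ι ι ℕ}
  {ρ : Fin k → ℝ} {x : ι → ℝ} {δ : ℝ}

omit [NeZero k] in
theorem decayRate_lt_one_iff (hδ : 0 < δ) (hκ : 1 < growthRate ρ) (s : ℝ) :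
    decayRate ρ δ s < 1 ↔ δ < s := by
  rw [decayRate, Real.rpow_lt_one_iff_of_pos (one_pos.trans hκ)]
  rw [sub_neg, one_lt_div hδ]
  simp [hκ, hκ.not_gt]

omit [NeZero k] in
theorem tendsto_decayRate (hδ : 0 < δ) (hκ : 1 < growthRate ρ) :
    Tendsto (decayRate ρ δ) (𝓝[>] δ) (𝓝[<] 1) := by
  refine tendsto_nhdsWithin_iff.2 ⟨?_, ?_⟩
  · have h0 := (one_pos.trans hκ).ne'
    have h1 : Continuous (decayRate ρ δ) := by
      unfold decayRate
      exact Continuous.rpow continuous_const (by fun_prop) fun _ => Or.inl h0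
    have h2 : decayRate ρ δ δ = 1 := by rw [decayRate, div_self hδ.ne', sub_self, Real.rpow_zero]
    exact h2 ▸ (h1.tendsto δ).mono_left nhdsWithin_le_nhds
  · filter_upwards [self_mem_nhdsWithin] with s hs
    exact (decayRate_lt_one_iff hδ hκ s).2 hs

theorem pathSum_sourceWeight_ne_zero (hρ : ∀ i, 0 < ρ i) (hx : ∀ p, 0 < x p) (s : ℝ) :
    (stationary A).pathSum (sourceWeight ρ x δ) s ≠ 0 := by
  obtain ⟨p⟩ := ‹Nonempty ι›
  refine fun h => ?_
  have h1 := ENNReal.tsum_eq_zero.1 h ⟨0, p, .vertex (B := stationary A) p⟩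
  exact (Real.rpow_pos_of_pos (sourceWeight_pos hρ hx _) s).not_ge (ENNReal.ofReal_eq_zero.1 h1)

variable (hρ : ∀ i, 0 < ρ i) (hx : ∀ p, 0 < x p)
  (hA : ∀ i p, ∑ q, (A i p q : ℝ) * x q = ρ i * x p) (hκ : 1 < growthRate ρ)
  (hδ : 0 < δ)
include hδ hρ hx hA hκ

theorem pathSum_lt_top_iff (s : ℝ) :
    (stationary A).pathSum (sourceWeight ρ x δ) s < ∞ ↔ δ < s := by
  rw [← decayRate_lt_one_iff hδ hκ]
  constructor
  · intro h
    by_contra! hle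
    exact h.ne (pathSum_eq_top hρ hx hA hle)
  · intro h
    rw [pathSum_eq_ofReal hρ hx hA h]
    exact ENNReal.ofReal_lt_top

-- The vector to which the Abel means apply also varies with `s`, but it is continuous and positive
-- at `δ`.
omit [Nonempty ι] in
theorem exists_tendsto_transferSum : ∃ Y : Fin k × ι → ℝ, (∀ a, 0 < Y a) ∧ ∀ a,
    Tendsto (fun s => (1 - decayRate ρ δ s) * transferSum A ρ x δ s a) (𝓝[>] δ) (𝓝 (Y a)) := by
  refine exists_tendsto_abel_of_tendsto (transfer_nonneg hρ) (transfer_eigenvector hρ hA)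
    (fun _ => hx _) (boundedFactor_pos (δ := δ) hρ hx δ) (fun a => ?_) (tendsto_decayRate hδ hκ)
  have h1 : Continuous fun s => boundedFactor ρ x δ s a := by
    unfold boundedFactor
    exact (Continuous.rpow continuous_const (by fun_prop)
      fun _ => Or.inl (periodicFactor_pos hρ _).ne').mul
      (Continuous.rpow continuous_const (by fun_prop) fun _ => Or.inl (hx _).ne')
  exact (h1.tendsto δ).mono_left nhdsWithin_le_nhds

/-- The ratios that define the measure of a cylinder set converge to a finite limit, and each
single summand is negligible. -/
theorem exists_tendsto_extensionSum_div :
    ∃ c : (stationary A).FinitePath → ℝ≥0∞, ∀ γ,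
      Tendsto (fun s => (stationary A).extensionSum (sourceWeight ρ x δ) γ s /
        (stationary A).pathSum (sourceWeight ρ x δ) s) (𝓝[>] δ) (𝓝 (c γ)) ∧
      Tendsto (fun s => ENNReal.ofReal (sourceWeight ρ x δ γ ^ s) /
        (stationary A).pathSum (sourceWeight ρ x δ) s) (𝓝[>] δ) (𝓝 0) := by
  obtain ⟨Y, hYpos, hY⟩ := exists_tendsto_transferSum hρ hx hA hκ hδ
  have hr : Tendsto (decayRate ρ δ) (𝓝[>] δ) (𝓝 1) :=
    (tendsto_decayRate hδ hκ).mono_right nhdsWithin_le_nhds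
  have hZpos : 0 < ∑ p, Y (0, p) := Finset.sum_pos (fun p _ => hYpos _) Finset.univ_nonempty
  have hZ : Tendsto (fun s => (1 - decayRate ρ δ s) * ∑ p, transferSum A ρ x δ s (0, p)) (𝓝[>] δ)
      (𝓝 (∑ p, Y (0, p))) := by
    simp only [Finset.mul_sum]
    exact tendsto_finsetSum _ fun p _ => hY _
  -- The factor `1 - decayRate` cancels from the quotient, and the scaled denominator has a positive
  -- limit.
  have hratio : ∀ {g : ℝ → ℝ} {b : ℝ},
      Tendsto (fun s => (1 - decayRate ρ δ s) * g s) (𝓝[>] δ) (𝓝 b) →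
      Tendsto (fun s => ENNReal.ofReal (g s) /
        (stationary A).pathSum (sourceWeight ρ x δ) s) (𝓝[>] δ)
        (𝓝 (ENNReal.ofReal (b / ∑ p, Y (0, p)))) := by
    intro g b hg
    refine (ENNReal.tendsto_ofReal (hg.div hZ hZpos.ne')).congr' ?_
    filter_upwards [self_mem_nhdsWithin, hZ.eventually_const_lt hZpos] with s hs hs'
    have h1 : decayRate ρ δ s < 1 := (decayRate_lt_one_iff hδ hκ s).2 hs
    have h2 : 0 < 1 - decayRate ρ δ s := sub_pos.2 h1
    rw [pathSum_eq_ofReal hρ hx hA h1, ← ENNReal.ofReal_div_of_pos (pos_of_mul_pos_right hs' h2.le),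
      Pi.div_apply, mul_div_mul_left _ _ h2.ne']
  refine ⟨fun γ => ENNReal.ofReal (((levelProd ρ γ.1)⁻¹ *
    (1 ^ γ.1 * Y (Fin.ofNat k γ.1, γ.2.1))) / ∑ p, Y (0, p)), fun γ => ⟨?_, ?_⟩⟩
  · have h1 := ((hr.pow γ.1).mul (hY (Fin.ofNat k γ.1, γ.2.1))).const_mul (levelProd ρ γ.1)⁻¹
    have h2 : Tendsto (fun s => (1 - decayRate ρ δ s) * ((levelProd ρ γ.1)⁻¹ *
        (decayRate ρ δ s ^ γ.1 * transferSum A ρ x δ s (Fin.ofNat k γ.1, γ.2.1)))) (𝓝[>] δ)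
        (𝓝 ((levelProd ρ γ.1)⁻¹ * (1 ^ γ.1 * Y (Fin.ofNat k γ.1, γ.2.1)))) :=
      h1.congr fun s => by ring
    refine (hratio h2).congr' ?_
    filter_upwards [self_mem_nhdsWithin] with s hs
    rw [extensionSum_eq_ofReal hρ hx hA ((decayRate_lt_one_iff hδ hκ s).2 hs)]
  -- A single summand has a finite limit, so multiplication by `1 - decayRate` sends it to zero.
  · have hcont : Continuous fun s : ℝ => sourceWeight (A := A) ρ x δ γ ^ s :=
      Continuous.rpow continuous_const continuous_id
        fun _ => Or.inl (sourceWeight_pos hρ hx γ).ne'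
    have h1 := (hr.const_sub 1).mul ((hcont.tendsto δ).mono_left nhdsWithin_le_nhds)
    rw [sub_self, zero_mul] at h1
    simpa using hratio h1

end Limits

end BratteliDiagram

/-! ### Assembly of the theorem. -/

/-- Strong connectivity alone allows a single vertex without edges, where the radii vanish. An
infinite path uses an edge of every `A i`, and the eigenvector equation at its range forces a
positive radius. -/
theorem natSpectralRadius_pos_of_infinitePath {k : ℕ} [NeZero k] {ι : Type u} [Fintype ι]
    [DecidableEq ι] {A : Fin k → Matrix ι ι ℕ} {x : ι → ℝ} (h : IsPerronFrobenius A x)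
    (y : (BratteliDiagram.stationary A).InfinitePath) (i : Fin k) :
    0 < natSpectralRadius (A i) := by
  have h1 : Fin.ofNat k i.val = i := Fin.ext (Nat.mod_eq_of_lt i.2)
  have h2 : Fin (A (Fin.ofNat k i.val) (y.vertex i) (y.vertex (i + 1))) := y.edge i
  rw [h1] at h2
  have h3 := congrFun (h.2.2 i) (y.vertex i)
  simp only [Matrix.mulVec, dotProduct, Matrix.map_apply, Pi.smul_apply, smul_eq_mul] at h3
  refine pos_of_mul_pos_left ?_ (h.1 (y.vertex i)).le
  rw [← h3]
  exact Finset.sum_pos' (fun q _ => mul_nonneg (Nat.cast_nonneg _) (h.1 q).le)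
    ⟨_, Finset.mem_univ _, mul_pos (Nat.cast_pos.2 (Fin.pos h2)) (h.1 _)⟩

theorem mainTheorem2 {k : ℕ} [NeZero k] {Λ : Type u} [Category.{v} Λ] [Fintype Λ] [DecidableEq Λ]
    [Nonempty Λ] (G : KGraph k Λ) (hfin : G.IsFinite) (hconn : G.IsStronglyConnected)
    (δ : ℝ) (hδ0 : 0 < δ) (hδ1 : δ < 1)
    (hdiam : ∀ γ : G.bratteli.FinitePath,
      G.weight δ γ = G.bratteli.diam (G.weight δ) γ) :
    (∀ s : ℝ, G.bratteli.zeta (G.weight δ) s < ∞ ↔ δ < s) ∧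
    ∃ μ : Measure G.bratteli.InfinitePath, IsFiniteMeasure μ ∧
      (∀ γ : G.bratteli.FinitePath,
        Tendsto (fun s : ℝ => G.bratteli.extensionSum (G.weight δ) γ s /
            G.bratteli.zeta (G.weight δ) s)
          (𝓝[>] δ) (𝓝 (μ (G.bratteli.cylinder γ)))) ∧
      (∀ ν : Measure G.bratteli.InfinitePath, IsFiniteMeasure ν →
        (∀ γ : G.bratteli.FinitePath,
          Tendsto (fun s : ℝ => G.bratteli.extensionSum (G.weight δ) γ s /
              G.bratteli.zeta (G.weight δ) s)
            (𝓝[>] δ) (𝓝 (ν (G.bratteli.cylinder γ)))) → ν = μ) ∧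
      (∀ (τ : G.bratteli.ChoiceFunction (G.weight δ)) (f : G.bratteli.InfinitePath → ℂ),
        G.bratteli.IsLipschitz (G.weight δ) f →
          Integrable f μ ∧ G.bratteli.HasDixmierTrace τ δ f (∫ x, f x ∂μ)) := by

  set x := perronFrobenius G.adjacency with hxdef
  set ρ : Fin k → ℝ := fun i => natSpectralRadius (G.adjacency i) with hρdef
  have hPF : IsPerronFrobenius G.adjacency x :=
    KGraph.isPerronFrobenius_perronFrobenius hfin hconn
  have hx : ∀ p, 0 < x p := hPF.1
  have hA : ∀ i p, ∑ q, (G.adjacency i p q : ℝ) * x q = ρ i * x p := fun i p =>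
    congrFun (hPF.2.2 i) p
  have hweight : G.weight δ =
      BratteliDiagram.sourceWeight (A := G.adjacency) ρ x δ := rfl
  rw [hweight] at hdiam ⊢
  have hρ : ∀ i, 0 < ρ i := by
    obtain ⟨p⟩ := ‹Nonempty Λ›
    -- At length zero the product is one, so the weight is positive before anything is known about
    -- the radii.
    let γ : G.bratteli.FinitePath := ⟨0, p, .vertex (B := G.bratteli) p⟩
    have h1 : 0 < BratteliDiagram.sourceWeight (A := G.adjacency) ρ x δ γ := by
      rw [BratteliDiagram.sourceWeight, levelProd_zero, Real.one_rpow, one_mul]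
      exact hx p
    obtain ⟨y, -⟩ := BratteliDiagram.exists_ne_of_diam_pos (hdiam γ ▸ h1)
    exact natSpectralRadius_pos_of_infinitePath hPF y
  have hw : ∀ γ, 0 < BratteliDiagram.sourceWeight (A := G.adjacency) ρ x δ γ :=
    BratteliDiagram.sourceWeight_pos hρ hx
  have htwo : ∀ γ, ∃ y ∈ G.bratteli.cylinder γ, ∃ y' ∈ G.bratteli.cylinder γ, y ≠ y' := fun γ =>
    BratteliDiagram.exists_ne_of_diam_pos (hdiam γ ▸ hw γ)
  have hκ : 1 < growthRate ρ := BratteliDiagram.one_lt_growthRate hρ hx hA htwo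
  have hzeta : ∀ s, G.bratteli.zeta (BratteliDiagram.sourceWeight ρ x δ) s =
      G.bratteli.pathSum (BratteliDiagram.sourceWeight ρ x δ) s :=
    BratteliDiagram.zeta_eq_pathSum hw hdiam
  simp only [hzeta]
  have hiff := BratteliDiagram.pathSum_lt_top_iff hρ hx hA hκ hδ0
  have hne0 := BratteliDiagram.pathSum_sourceWeight_ne_zero (A := G.adjacency) (δ := δ) hρ hx
  obtain ⟨c, hc⟩ := BratteliDiagram.exists_tendsto_extensionSum_div hρ hx hA hκ hδ0
  obtain ⟨P, hP, hPc, hPf⟩ := BratteliDiagram.exists_tendsto_pointMeasure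
    (l := 𝓝[>] δ)
    (fun γ => let ⟨y, hy, _⟩ := htwo γ; ⟨y, hy⟩) hne0
    (eventually_nhdsWithin_of_forall fun s hs => ((hiff s).2 hs).ne)
    (fun γ => (hc γ).2) fun γ => (hc γ).1
  refine ⟨hiff, P, inferInstance, fun γ => hPc γ ▸ (hc γ).1, fun ν _ hν => ?_, fun τ f hf => ?_⟩
  · refine BratteliDiagram.InfinitePath.measure_ext fun γ => ?_
    exact (tendsto_nhds_unique (hν γ) (hc γ).1).trans (hPc γ).symm
  -- Any exponent above `δ` gives the summability needed here.
  · have hcont : Continuous f := hf.continuous hw (add_pos hδ0 one_pos)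
      (BratteliDiagram.summable_of_pathSum_ne_top hw ((hiff (δ + 1)).2 (lt_add_one δ)).ne)
    obtain ⟨C, hC⟩ := BratteliDiagram.exists_norm_le_of_continuous hcont
    exact ⟨Integrable.of_bound hcont.aestronglyMeasurable C (Eventually.of_forall hC),
      BratteliDiagram.hasDixmierTrace_of_tendsto hw hdiam hne0
        (fun s hs => ((hiff s).2 hs).ne) hPf τ hcont⟩
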